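/- A randomized inner-product (IP) query algorithm for two unknown real $n\times n$ matrices $A$ and $B$ is an adaptive procedure that always halts and outputs a real number. At each step it may draw a uniformly random element of a finite set, or make an IP query: it names one of the two matrices $M\in\{A,B\}$, a row or column index $i\in[n]$ and a vector $v\in\{0,1\}^n$, and receives $\langle M(i,*),v\rangle$ or $\langle M(*,i),v\rangle$ respectively. It has no other access to the matrices; only IP queries are counted as cost. Write $\mathbf D_{\mathbf M}(A,B)=|\{(i,j)\in[n]\times[n]: A(i,j)\neq B(i,j)\}|$. **Lemma (Estimating the distance between two symmetric matrices).** For every positive integer $c$ there is a randomized IP query algorithm Dist-Symm-Matrix, taking as input $n\ge 1$ and $\epsilon\in(0,\tfrac12)$, and there are constants $C,k$ depending only on $c$, such that for all $n\geq 1$, all $\epsilon\in(0,\tfrac12)$ and all symmetric matrices $A,B\in\mathbb R^{n\times n}$, with probability at least $1-n^{-c}$ both of the following hold: the output $\widehat d$ is a $(1\pm\epsilon)$-approximation to $\mathbf D_{\mathbf M}(A,B)$, that is, $$\bigl|\widehat d-\mathbf D_{\mathbf M}(A,B)\bigr|\le \epsilon\,\mathbf D_{\mathbf M}(A,B),$$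 and the number of IP queries made is at most $$C\left(\frac{1+\log n}{\epsilon}\right)^{k}\cdot\frac{n}{\sqrt{\max\{\mathbf D_{\mathbf M}(A,B),\,1\}}},$$ i.e. it is $\widetilde{O}\bigl(n/\sqrt{\mathbf D_{\mathbf M}(A,B)}\bigr)$, where $\widetilde O$ hides a factor polynomial in $\log n$ and $1/\epsilon$. The algorithm is not given $\mathbf D_{\mathbf M}(A,B)$ or any guess for it. -/

import Mathlib

/-- Which of the two unknown matrices a query is addressed to. -/
inductive MatrixName where
  | A : MatrixName
  | B : MatrixName

/-- Whether an inner-product query projects a row or a column. -/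
inductive LineKind where
  | row : LineKind
  | col : LineKind

/-- An inner-product (IP) query to a pair of unknown `n × n` matrices: one of the two matrices,
a row or column index, and a vector in `{0,1}^n`. -/
structure IPQuery (n : ℕ) where
  target : MatrixName
  kind : LineKind
  index : Fin n
  vec : Fin n → Bool

/-- The real vector with coordinates `0` and `1` given by a Boolean vector. -/
def boolVec {n : ℕ} (v : Fin n → Bool) : Fin n → ℝ :=
  fun j => if v j then 1 else 0

/-- The answer of the IP oracle: the inner product of the chosen row `M(i,*)` or column `M(*,i)`
of the chosen matrix with the `0/1` vector of the query. -/
noncomputable def IPQuery.answer {n : ℕ} (A B : Matrix (Fin n) (Fin n) ℝ) (q : IPQuery n) : ℝ :=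
  let M : Matrix (Fin n) (Fin n) ℝ :=
    match q.target with
    | MatrixName.A => A
    | MatrixName.B => B
  match q.kind with
  | LineKind.row => M.row q.index ⬝ᵥ boolVec q.vec
  | LineKind.col => M.col q.index ⬝ᵥ boolVec q.vec

/-- A randomized adaptive algorithm with IP query access to two unknown `n × n` real matrices,
as a decision tree in which every branch is finite. At each step it either halts and outputs a
real number, or draws a uniformly random element of a finite nonempty set `{0, …, m}`, or makes an
IP query; it then continues in a way that depends on the outcome of the draw or on the answer of
the oracle. The matrices are accessible through the queries only. -/
inductive IPAlgorithm (n : ℕ) : Type where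
  | output : ℝ → IPAlgorithm n
  | draw : (m : ℕ) → (Fin (m + 1) → IPAlgorithm n) → IPAlgorithm n
  | query : IPQuery n → (ℝ → IPAlgorithm n) → IPAlgorithm n

/-- The joint law of the output and of the number of IP queries made, when the algorithm is run
on the matrices `A` and `B`. -/
noncomputable def IPAlgorithm.run {n : ℕ} (A B : Matrix (Fin n) (Fin n) ℝ) :
    IPAlgorithm n → PMF (ℝ × ℕ)
  | IPAlgorithm.output d => PMF.pure (d, 0)
  | IPAlgorithm.draw m next =>
      (PMF.uniformOfFintype (Fin (m + 1))).bind fun i => IPAlgorithm.run A B (next i)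
  | IPAlgorithm.query q next =>
      (IPAlgorithm.run A B (next (q.answer A B))).map fun r => (r.1, r.2 + 1)

/-- The probability that, on the matrices `A` and `B`, the output `d` of the algorithm and the
number `q` of IP queries made satisfy `E d q`. -/
noncomputable def IPAlgorithm.prob {n : ℕ} (alg : IPAlgorithm n) (A B : Matrix (Fin n) (Fin n) ℝ)
    (E : ℝ → ℕ → Prop) : ℝ :=
  ((alg.run A B).toOuterMeasure {r : ℝ × ℕ | E r.1 r.2}).toReal

/-- The matrix distance: the number of entries in which `A` and `B` differ. -/
noncomputable def matrixDist {n : ℕ} (A B : Matrix (Fin n) (Fin n) ℝ) : ℕ :=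
  (Finset.univ.filter fun p : Fin n × Fin n => A p.1 p.2 ≠ B p.1 p.2).card

/-- `d` is a `(1 ± ε)`-approximation to `a`. -/
def IsApprox (ε d a : ℝ) : Prop :=
  |d - a| ≤ ε * a

/-!
Let `D` be the number of entries in which the symmetric matrices `A` and `B` differ, and let `N i`
be the set of columns in which their rows `i` differ. Think of the `N i` as the neighbourhoods of a
graph with loops, so that `D` is the sum of the degrees `|N i|`.

**Access to the rows.** A random Boolean vector, restricted to a set `U` of columns, separates the
rows `i` of `A` and `B` with probability at least `1/2` if they differ somewhere in `U`
(`two_mul_card_sum_eq_zero_le`). A logarithmic number of such vectors, reused for all rows and all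
intervals, therefore gives correct zero tests throughout
(`QueryProg.uniformProb_not_testsCorrect_le`), and bisection with these tests enumerates the first
few elements of `N i ∩ S` for any set `S` of columns (`QueryProg.eval_enumerate`).

**One guess.** Suppose that `D ≤ s ^ 2`. Fix one random set of columns of density `1 / s` and call
a row heavy if its set `N i` has at least `K` elements there; with high probability heavy rows have
more than `K s / 4` elements and light rows fewer than `2 K s`. Classifying all rows by one shared
random set makes heaviness a fixed property of a row. Give a light row the weight
`|N i| + |N i ∩ heavy|` and a heavy row the weight `0`. By symmetry the weights add up to `D` minus
the number of differing entries in heavy rows and heavy columns (`sum_rowWeight_bounds`), and these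
are few because there are few heavy rows (`sq_card_heavy_le`). As all weights are `O(K s)`, a sample
of about `n / s` rows suffices to estimate their sum. The weight of a sampled row is itself
estimated by enumerating `N i` in a fresh random set of columns of density `1 / s`, which contains
only `O(K)` elements of `N i`. All concentration statements come from one Chernoff bound,
`uniformProb_chernoff`, and `prob_guessAlg_le` combines them: the error is at most
`ε * max D (s ^ 2 / 16)`.

**Search.** The guesses `s ^ 2` decrease by factors of `4` from above `n ^ 2`, and the search stops
when the estimate reaches `s ^ 2 / 8`. By the error bound it cannot stop while `D < s ^ 2 / 16`, so
the estimate is then accurate, and it cannot go on while `D > s ^ 2 / 4`, so `D ≤ s ^ 2` holds for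
every guess tried and each of them costs `O(n / s)`, hence `O(n / √D)`, queries up to the hidden
factors (`prob_guessLoop_le`).
-/

/-! ### Uniform probability on finite sets -/

open Classical in
/-- The probability of the event `p` for a uniformly random element of the finite type `Ω`. -/
noncomputable def uniformProb {Ω : Type*} [Fintype Ω] (p : Ω → Prop) : ℝ :=
  ((Finset.univ.filter p).card : ℝ) / Fintype.card Ω

section UniformProb

variable {Ω : Type*} [Fintype Ω]

lemma uniformProb_eq (p : Ω → Prop) [DecidablePred p] :
    uniformProb p = ((Finset.univ.filter p).card : ℝ) / Fintype.card Ω := by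
  unfold uniformProb
  congr!

lemma uniformProb_mono {p q : Ω → Prop} (h : ∀ ω, p ω → q ω) :
    uniformProb p ≤ uniformProb q := by
  classical
  rw [uniformProb_eq, uniformProb_eq]
  gcongr with ω
  exact h ω

lemma uniformProb_or_le (p q : Ω → Prop) :
    uniformProb (fun ω => p ω ∨ q ω) ≤ uniformProb p + uniformProb q := by
  classical
  rw [uniformProb_eq, uniformProb_eq, uniformProb_eq, ← add_div]
  gcongr
  rw [Finset.filter_or]
  exact_mod_cast Finset.card_union_le _ _

lemma uniformProb_exists_le {κ : Type*} [Fintype κ] (p : κ → Ω → Prop) {δ : ℝ}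
    (h : ∀ k, uniformProb (p k) ≤ δ) :
    uniformProb (fun ω => ∃ k, p k ω) ≤ Fintype.card κ * δ := by
  classical
  have hsub : (Finset.univ.filter fun ω => ∃ k, p k ω) ⊆
      Finset.univ.biUnion fun k => Finset.univ.filter (p k) := by
    intro ω hω
    simpa using hω
  have hcard : ((Finset.univ.filter fun ω => ∃ k, p k ω).card : ℝ) ≤
      ∑ k, ((Finset.univ.filter (p k)).card : ℝ) := by
    exact_mod_cast (Finset.card_le_card hsub).trans Finset.card_biUnion_le
  calc uniformProb (fun ω => ∃ k, p k ω)
      ≤ (∑ k, ((Finset.univ.filter (p k)).card : ℝ)) / Fintype.card Ω := by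
        rw [uniformProb_eq]
        gcongr
    _ = ∑ k, uniformProb (p k) := by
        rw [Finset.sum_div]
        exact Finset.sum_congr rfl fun k _ => (uniformProb_eq _).symm
    _ ≤ ∑ _k : κ, δ := Finset.sum_le_sum fun k _ => h k
    _ = Fintype.card κ * δ := by simp

/-- Markov's inequality. -/
lemma uniformProb_le_of_one_le {p : Ω → Prop} {g : Ω → ℝ} (hg : ∀ ω, 0 ≤ g ω)
    (hp : ∀ ω, p ω → 1 ≤ g ω) : uniformProb p ≤ (∑ ω, g ω) / Fintype.card Ω := by
  classical
  rw [uniformProb_eq]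
  gcongr
  calc ((Finset.univ.filter p).card : ℝ) = ∑ ω ∈ Finset.univ.filter p, (1 : ℝ) := by simp
    _ ≤ ∑ ω ∈ Finset.univ.filter p, g ω :=
        Finset.sum_le_sum fun ω hω => hp ω (Finset.mem_filter.mp hω).2
    _ ≤ ∑ ω, g ω :=
        Finset.sum_le_sum_of_subset_of_nonneg (Finset.filter_subset _ _) fun ω _ _ => hg ω

end UniformProb

/-! ### Chernoff bounds for independent bounded variables -/

section Chernoff

variable {ι Ω : Type*} [Fintype ι] [DecidableEq ι] [Fintype Ω] [Nonempty Ω]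

/-- Bound on the exponential moment of a sum of independent `[0,1]`-valued variables. -/
lemma sum_exp_sum_le {X : ι → Ω → ℝ} (h0 : ∀ i ω, 0 ≤ X i ω) (h1 : ∀ i ω, X i ω ≤ 1)
    {θ : ℝ} (hθ : |θ| ≤ 1) :
    (∑ ω : ι → Ω, Real.exp (θ * ∑ i, X i (ω i))) / Fintype.card (ι → Ω) ≤
      Real.exp ((θ + θ ^ 2) * ∑ i, (∑ v, X i v) / Fintype.card Ω) := by
  have hN : (0 : ℝ) < Fintype.card Ω := by exact_mod_cast Fintype.card_pos
  have hfac : ∑ ω : ι → Ω, Real.exp (θ * ∑ i, X i (ω i)) =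
      ∏ i, ∑ v, Real.exp (θ * X i v) := by
    rw [Fintype.prod_sum]
    refine Finset.sum_congr rfl fun ω _ => ?_
    rw [Finset.mul_sum, Real.exp_sum]
  have hone : ∀ i, (∑ v, Real.exp (θ * X i v)) / Fintype.card Ω ≤
      Real.exp ((θ + θ ^ 2) * ((∑ v, X i v) / Fintype.card Ω)) := by
    intro i
    have hpt : ∀ v, Real.exp (θ * X i v) ≤ 1 + (θ + θ ^ 2) * X i v := by
      intro v
      have hx0 := h0 i v
      have hx1 := h1 i v
      have habs : |θ * X i v| ≤ 1 := by
        rw [abs_mul, abs_of_nonneg hx0]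
        exact mul_le_one₀ hθ hx0 hx1
      have h2 := (abs_le.mp (Real.abs_exp_sub_one_sub_id_le habs)).2
      have h3 : (θ * X i v) ^ 2 ≤ θ ^ 2 * X i v := by
        rw [mul_pow]
        gcongr
        nlinarith
      linarith
    have hsum : (∑ v, Real.exp (θ * X i v)) / Fintype.card Ω ≤
        1 + (θ + θ ^ 2) * ((∑ v, X i v) / Fintype.card Ω) := by
      rw [div_le_iff₀ hN]
      calc ∑ v, Real.exp (θ * X i v) ≤ ∑ v, (1 + (θ + θ ^ 2) * X i v) :=
            Finset.sum_le_sum fun v _ => hpt v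
        _ = (1 + (θ + θ ^ 2) * ((∑ v, X i v) / Fintype.card Ω)) * Fintype.card Ω := by
            rw [Finset.sum_add_distrib, ← Finset.mul_sum]
            simp only [Finset.sum_const, Finset.card_univ, nsmul_eq_mul, mul_one]
            field_simp
    have := Real.add_one_le_exp ((θ + θ ^ 2) * ((∑ v, X i v) / Fintype.card Ω))
    linarith
  calc (∑ ω : ι → Ω, Real.exp (θ * ∑ i, X i (ω i))) / Fintype.card (ι → Ω)
      = ∏ i, (∑ v, Real.exp (θ * X i v)) / Fintype.card Ω := by
        rw [hfac, Finset.prod_div_distrib]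
        simp
    _ ≤ ∏ i, Real.exp ((θ + θ ^ 2) * ((∑ v, X i v) / Fintype.card Ω)) :=
        Finset.prod_le_prod (fun i _ => by positivity) fun i _ => hone i
    _ = _ := by rw [← Real.exp_sum, Finset.mul_sum]

/-- Two-sided Chernoff bound. Allowing any `a` above the mean `μ` in place of `μ` gives a
multiplicative error for large means and an additive error for small ones. -/
lemma uniformProb_chernoff {X : ι → Ω → ℝ} (h0 : ∀ i ω, 0 ≤ X i ω) (h1 : ∀ i ω, X i ω ≤ 1)
    {μ a ε : ℝ} (hμ : ∑ i, (∑ v, X i v) / Fintype.card Ω = μ) (ha : μ ≤ a)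
    (hε0 : 0 < ε) (hε1 : ε ≤ 1) :
    uniformProb (fun ω : ι → Ω => ε * a < |∑ i, X i (ω i) - μ|) ≤
      2 * Real.exp (-(ε ^ 2 * a / 4)) := by
  set θ : ℝ := ε / 2 with hθdef
  have hθ0 : 0 < θ := by positivity
  have hθ1 : |θ| ≤ 1 := by rw [abs_of_pos hθ0]; linarith
  have hθ1' : |-θ| ≤ 1 := by rwa [abs_neg]
  set N : ℝ := (Fintype.card (ι → Ω) : ℝ)
  have hup := sum_exp_sum_le h0 h1 hθ1
  have hlo := sum_exp_sum_le h0 h1 hθ1'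
  rw [hμ] at hup hlo
  have hexp : ∀ b : ℝ, b ≤ θ ^ 2 * μ - θ * (ε * a) →
      Real.exp b ≤ Real.exp (-(ε ^ 2 * a / 4)) := by
    intro b hb
    refine Real.exp_le_exp.mpr (hb.trans ?_)
    have : θ ^ 2 * μ ≤ θ ^ 2 * a := by gcongr
    rw [hθdef] at this ⊢
    nlinarith
  calc uniformProb (fun ω : ι → Ω => ε * a < |∑ i, X i (ω i) - μ|)
      ≤ (∑ ω : ι → Ω, (Real.exp (θ * ∑ i, X i (ω i)) * Real.exp (-θ * μ - θ * (ε * a)) +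
          Real.exp (-θ * ∑ i, X i (ω i)) * Real.exp (θ * μ - θ * (ε * a)))) / N := by
        refine uniformProb_le_of_one_le (fun ω => by positivity) fun ω hω => ?_
        rw [← Real.exp_add, ← Real.exp_add]
        rcases lt_abs.mp hω with h | h
        · have : 1 ≤ Real.exp (θ * ∑ i, X i (ω i) + (-θ * μ - θ * (ε * a))) :=
            Real.one_le_exp (by nlinarith)
          have := Real.exp_pos (-θ * ∑ i, X i (ω i) + (θ * μ - θ * (ε * a)))
          linarith
        · have : 1 ≤ Real.exp (-θ * ∑ i, X i (ω i) + (θ * μ - θ * (ε * a))) :=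
            Real.one_le_exp (by nlinarith)
          have := Real.exp_pos (θ * ∑ i, X i (ω i) + (-θ * μ - θ * (ε * a)))
          linarith
    _ = (∑ ω : ι → Ω, Real.exp (θ * ∑ i, X i (ω i))) / N * Real.exp (-θ * μ - θ * (ε * a)) +
        (∑ ω : ι → Ω, Real.exp (-θ * ∑ i, X i (ω i))) / N *
          Real.exp (θ * μ - θ * (ε * a)) := by
        rw [Finset.sum_add_distrib, ← Finset.sum_mul, ← Finset.sum_mul]
        ring
    _ ≤ Real.exp ((θ + θ ^ 2) * μ) * Real.exp (-θ * μ - θ * (ε * a)) +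
        Real.exp ((-θ + (-θ) ^ 2) * μ) * Real.exp (θ * μ - θ * (ε * a)) := by
        gcongr
    _ ≤ Real.exp (-(ε ^ 2 * a / 4)) + Real.exp (-(ε ^ 2 * a / 4)) := by
        rw [← Real.exp_add, ← Real.exp_add]
        exact add_le_add (hexp _ (by linarith)) (hexp _ (by linarith))
    _ = _ := by ring

/-- Chernoff bound for a weighted count of the points that a uniformly random function to
`Fin s` sends to `0`. -/
lemma uniformProb_chernoff_subsample {s : ℕ} [NeZero s] {w : ι → ℝ} (h0 : ∀ i, 0 ≤ w i)
    (h1 : ∀ i, w i ≤ 1) {a ε : ℝ} (ha : (∑ i, w i) / s ≤ a) (hε0 : 0 < ε) (hε1 : ε ≤ 1) :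
    uniformProb (fun f : ι → Fin s =>
        ε * a < |(∑ i, if f i = 0 then w i else 0) - (∑ i, w i) / s|) ≤
      2 * Real.exp (-(ε ^ 2 * a / 4)) := by
  refine uniformProb_chernoff (X := fun i (v : Fin s) => if v = 0 then w i else 0)
    (fun i v => by split_ifs <;> simp [h0]) (fun i v => by split_ifs <;> simp [h1]) ?_ ha hε0 hε1
  simp [Finset.sum_div]

end Chernoff

/-! ### Zero testing with random Boolean vectors -/

/-- A nonzero linear form vanishes on at most half of the Boolean vectors: flipping a coordinate
with nonzero coefficient changes its value. -/
lemma two_mul_card_sum_eq_zero_le {n : ℕ} (x : Fin n → ℝ) (hx : ∃ j, x j ≠ 0) :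
    2 * (Finset.univ.filter fun v : Fin n → Bool => (∑ j, if v j then x j else 0) = 0).card ≤
      Fintype.card (Fin n → Bool) := by
  classical
  obtain ⟨j, hj⟩ := hx
  set Z := Finset.univ.filter fun v : Fin n → Bool => (∑ j, if v j then x j else 0) = 0 with hZ
  let flip : (Fin n → Bool) → (Fin n → Bool) := fun v => Function.update v j (!v j)
  have hflip : Function.Involutive flip := by
    intro v
    ext i
    by_cases h : i = j
    · subst h; simp [flip]
    · simp [flip, h]
  have hdisj : Disjoint Z (Z.image flip) := by
    rw [Finset.disjoint_left]
    intro v hv hv'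
    obtain ⟨u, hu, rfl⟩ := Finset.mem_image.mp hv'
    have hu0 : (∑ i, if u i then x i else 0) = 0 := by simpa [hZ] using hu
    have hv0 : (∑ i, if flip u i then x i else 0) = 0 := by simpa [hZ] using hv
    rw [← Finset.add_sum_erase _ _ (Finset.mem_univ j)] at hu0 hv0
    have hsame : ∑ i ∈ Finset.univ.erase j, (if flip u i then x i else 0) =
        ∑ i ∈ Finset.univ.erase j, (if u i then x i else 0) := by
      refine Finset.sum_congr rfl fun i hi => ?_
      simp [flip, Finset.ne_of_mem_erase hi]
    rw [hsame] at hv0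
    have : (if flip u j then x j else 0) = if u j then x j else 0 := by linarith
    cases h : u j <;> simp [flip, h] at this <;> exact hj (by simp [this])
  calc 2 * Z.card = (Z ∪ Z.image flip).card := by
        rw [Finset.card_union_of_disjoint hdisj, Finset.card_image_of_injective _ hflip.injective]
        ring
    _ ≤ _ := Finset.card_le_univ _

/-- The probability that none of `L` random Boolean vectors detects a given nonzero vector. -/
lemma uniformProb_forall_sum_eq_zero_le {n L : ℕ} (x : Fin n → ℝ) (hx : ∃ j, x j ≠ 0) :
    uniformProb (fun r : Fin L → Fin n → Bool => ∀ l, (∑ j, if r l j then x j else 0) = 0) ≤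
      (1 / 2) ^ L := by
  classical
  set Z := Finset.univ.filter fun v : Fin n → Bool => (∑ j, if v j then x j else 0) = 0 with hZ
  have hcard : (Finset.univ.filter fun r : Fin L → Fin n → Bool =>
      ∀ l, (∑ j, if r l j then x j else 0) = 0).card = Z.card ^ L := by
    have : (Finset.univ.filter fun r : Fin L → Fin n → Bool =>
        ∀ l, (∑ j, if r l j then x j else 0) = 0) = Fintype.piFinset fun _ => Z := by
      ext r; simp [hZ]
    rw [this, Fintype.card_piFinset]
    simp
  have h2 : 2 * (Z.card : ℝ) ≤ (Fintype.card (Fin n → Bool) : ℝ) := by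
    exact_mod_cast two_mul_card_sum_eq_zero_le x hx
  have hpos : (0 : ℝ) < Fintype.card (Fin n → Bool) := by exact_mod_cast Fintype.card_pos
  calc uniformProb (fun r : Fin L → Fin n → Bool => ∀ l, (∑ j, if r l j then x j else 0) = 0)
      = ((Z.card : ℝ) / Fintype.card (Fin n → Bool)) ^ L := by
        rw [uniformProb_eq, div_pow, hcard]
        simp
    _ ≤ (1 / 2) ^ L := by
        refine pow_le_pow_left₀ (by positivity) ?_ L
        rw [div_le_iff₀ hpos]
        linarith

/-! ### Probabilities of events for randomized algorithms -/

namespace IPAlgorithm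

variable {n : ℕ} {A B : Matrix (Fin n) (Fin n) ℝ}

lemma toOuterMeasure_ne_top (p : PMF (ℝ × ℕ)) (s : Set (ℝ × ℕ)) : p.toOuterMeasure s ≠ ⊤ :=
  ne_top_of_le_ne_top ENNReal.one_ne_top
    ((p.toOuterMeasure.mono (Set.subset_univ s)).trans
      ((p.toOuterMeasure_apply_eq_one_iff _).mpr (Set.subset_univ _)).le)

lemma prob_le_one (alg : IPAlgorithm n) (E : ℝ → ℕ → Prop) : alg.prob A B E ≤ 1 := by
  refine ENNReal.toReal_le_of_le_ofReal zero_le_one ?_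
  rw [ENNReal.ofReal_one]
  exact (((alg.run A B).toOuterMeasure.mono (Set.subset_univ _)).trans
      (((alg.run A B).toOuterMeasure_apply_eq_one_iff _).mpr (Set.subset_univ _)).le)

lemma prob_mono (alg : IPAlgorithm n) {E E' : ℝ → ℕ → Prop} (h : ∀ d q, E d q → E' d q) :
    alg.prob A B E ≤ alg.prob A B E' :=
  ENNReal.toReal_mono (toOuterMeasure_ne_top _ _)
    ((alg.run A B).toOuterMeasure.mono fun r hr => h r.1 r.2 hr)

lemma one_le_prob_add_prob_not (alg : IPAlgorithm n) (E : ℝ → ℕ → Prop) :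
    1 ≤ alg.prob A B E + alg.prob A B fun d q => ¬ E d q := by
  unfold prob
  rw [← ENNReal.toReal_add (toOuterMeasure_ne_top _ _) (toOuterMeasure_ne_top _ _),
    ← ENNReal.toReal_one]
  refine ENNReal.toReal_mono
    (ENNReal.add_ne_top.mpr ⟨toOuterMeasure_ne_top _ _, toOuterMeasure_ne_top _ _⟩) ?_
  have huniv : (alg.run A B).toOuterMeasure Set.univ = 1 :=
    ((alg.run A B).toOuterMeasure_apply_eq_one_iff _).mpr (Set.subset_univ _)
  rw [← huniv]
  refine le_trans ((alg.run A B).toOuterMeasure.mono ?_)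
    (MeasureTheory.measure_union_le (μ := (alg.run A B).toOuterMeasure) _ _)
  intro r _
  exact em (E r.1 r.2)

lemma prob_output_eq_zero {d : ℝ} {E : ℝ → ℕ → Prop} (h : ¬ E d 0) :
    (output d : IPAlgorithm n).prob A B E = 0 := by
  have : ¬ E (d, 0).1 (d, 0).2 := h
  simp [prob, run, PMF.toOuterMeasure_pure_apply, h]

lemma prob_query (q : IPQuery n) (next : ℝ → IPAlgorithm n) (E : ℝ → ℕ → Prop) :
    (query q next).prob A B E = (next (q.answer A B)).prob A B fun d c => E d (c + 1) := by
  simp [prob, run, PMF.toOuterMeasure_map_apply]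

lemma prob_draw (m : ℕ) (next : Fin (m + 1) → IPAlgorithm n) (E : ℝ → ℕ → Prop) :
    (draw m next).prob A B E = (∑ i, (next i).prob A B E) / (m + 1) := by
  unfold prob
  rw [run, PMF.toOuterMeasure_bind_apply, tsum_fintype, ENNReal.toReal_sum]
  · rw [Finset.sum_div]
    refine Finset.sum_congr rfl fun i _ => ?_
    rw [PMF.uniformOfFintype_apply, ENNReal.toReal_mul, ENNReal.toReal_inv]
    rw [Fintype.card_fin, ENNReal.toReal_natCast, div_eq_inv_mul]
    push_cast
    rfl
  · intro i _
    exact ENNReal.mul_ne_top (PMF.apply_ne_top _ _) (toOuterMeasure_ne_top _ _)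

/-- Draw a uniformly random element of an arbitrary finite nonempty type. -/
noncomputable def drawFrom (Ω : Type) [Fintype Ω] [Nonempty Ω] (next : Ω → IPAlgorithm n) :
    IPAlgorithm n :=
  draw (Fintype.card Ω - 1) fun i =>
    next ((Fintype.equivFin Ω).symm (Fin.cast (Nat.sub_add_cancel Fintype.card_pos) i))

lemma prob_drawFrom (Ω : Type) [Fintype Ω] [Nonempty Ω] (next : Ω → IPAlgorithm n)
    (E : ℝ → ℕ → Prop) :
    (drawFrom Ω next).prob A B E = (∑ ω, (next ω).prob A B E) / Fintype.card Ω := by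
  have hcard : Fintype.card Ω - 1 + 1 = Fintype.card Ω := Nat.sub_add_cancel Fintype.card_pos
  rw [drawFrom, prob_draw]
  congr 1
  · exact Equiv.sum_comp ((finCongr hcard).trans (Fintype.equivFin Ω).symm)
      fun ω => (next ω).prob A B E
  · exact_mod_cast hcard

/-- If the continuation fails with probability at most `δ₂` unless the drawn element is bad, then
drawing costs only the additional probability of a bad element. -/
lemma prob_drawFrom_le {Ω : Type} [Fintype Ω] [Nonempty Ω] {next : Ω → IPAlgorithm n}
    {E : ℝ → ℕ → Prop} {bad : Ω → Prop} {δ₁ δ₂ : ℝ} (hδ₂ : 0 ≤ δ₂)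
    (hbad : uniformProb bad ≤ δ₁) (hgood : ∀ ω, ¬ bad ω → (next ω).prob A B E ≤ δ₂) :
    (drawFrom Ω next).prob A B E ≤ δ₁ + δ₂ := by
  classical
  have hpos : (0 : ℝ) < Fintype.card Ω := by exact_mod_cast Fintype.card_pos
  rw [prob_drawFrom]
  calc (∑ ω, (next ω).prob A B E) / Fintype.card Ω
      ≤ (∑ ω, ((if bad ω then 1 else 0) + δ₂)) / Fintype.card Ω := by
        gcongr with ω
        split_ifs with h
        · linarith [prob_le_one (A := A) (B := B) (next ω) E]
        · linarith [hgood ω h]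
    _ = uniformProb bad + δ₂ := by
        rw [uniformProb_eq, Finset.sum_add_distrib]
        simp only [Finset.sum_boole, Finset.sum_const, Finset.card_univ, nsmul_eq_mul]
        field_simp
    _ ≤ δ₁ + δ₂ := by linarith

end IPAlgorithm

/-! ### Deterministic query programs -/

/-- A deterministic adaptive program that makes IP queries and returns a value of type `α`. -/
inductive QueryProg (n : ℕ) (α : Type) : Type where
  | ret : α → QueryProg n α
  | ask : IPQuery n → (ℝ → QueryProg n α) → QueryProg n α

namespace QueryProg

variable {n : ℕ} {α β : Type}

/-- Run one program and feed its result to the next. -/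
def bind : QueryProg n α → (α → QueryProg n β) → QueryProg n β
  | ret a, k => k a
  | ask q next, k => ask q fun x => (next x).bind k

/-- The value returned by a program when it is run on the matrices `A` and `B`. -/
noncomputable def eval (A B : Matrix (Fin n) (Fin n) ℝ) : QueryProg n α → α
  | ret a => a
  | ask q next => (next (q.answer A B)).eval A B

/-- The number of queries made by a program when it is run on the matrices `A` and `B`. -/
noncomputable def cost (A B : Matrix (Fin n) (Fin n) ℝ) : QueryProg n α → ℕ
  | ret _ => 0
  | ask q next => (next (q.answer A B)).cost A B + 1

/-- Run a program and continue with a randomized algorithm depending on its result. -/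
def thenAlg : QueryProg n α → (α → IPAlgorithm n) → IPAlgorithm n
  | ret a, k => k a
  | ask q next, k => IPAlgorithm.query q fun x => (next x).thenAlg k

variable {A B : Matrix (Fin n) (Fin n) ℝ}

@[simp] lemma eval_ret (a : α) : (ret a : QueryProg n α).eval A B = a := rfl

@[simp] lemma cost_ret (a : α) : (ret a : QueryProg n α).cost A B = 0 := rfl

@[simp] lemma eval_bind (p : QueryProg n α) (k : α → QueryProg n β) :
    (p.bind k).eval A B = (k (p.eval A B)).eval A B := by
  induction p with
  | ret a => rfl
  | ask q next ih => exact ih _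

@[simp] lemma cost_bind (p : QueryProg n α) (k : α → QueryProg n β) :
    (p.bind k).cost A B = p.cost A B + (k (p.eval A B)).cost A B := by
  induction p with
  | ret a => simp [bind, cost, eval]
  | ask q next ih =>
    have := ih (q.answer A B)
    simp only [bind, cost, eval]
    omega

lemma prob_thenAlg (p : QueryProg n α) (k : α → IPAlgorithm n) (E : ℝ → ℕ → Prop) :
    (p.thenAlg k).prob A B E =
      (k (p.eval A B)).prob A B fun d c => E d (c + p.cost A B) := by
  induction p generalizing E with
  | ret a => rfl
  | ask q next ih =>
    rw [thenAlg, IPAlgorithm.prob_query, ih]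
    simp only [cost, eval, Nat.add_assoc]

/-- Add up the results of a family of programs along a list. -/
noncomputable def sumList (p : β → QueryProg n ℝ) : List β → QueryProg n ℝ
  | [] => ret 0
  | b :: bs => (p b).bind fun x => (sumList p bs).bind fun y => ret (x + y)

@[simp] lemma eval_sumList (p : β → QueryProg n ℝ) (bs : List β) :
    (sumList p bs).eval A B = (bs.map fun b => (p b).eval A B).sum := by
  induction bs with
  | nil => rfl
  | cons b bs ih => simp [sumList, ih]

lemma cost_sumList_le {p : β → QueryProg n ℝ} {C : ℕ} (h : ∀ b, (p b).cost A B ≤ C)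
    (bs : List β) : (sumList p bs).cost A B ≤ bs.length * C := by
  induction bs with
  | nil => simp [sumList]
  | cons b bs ih =>
    have := h b
    simp only [sumList, cost_bind, cost_ret, List.length_cons, add_mul]
    omega

/-! ### Zero tests and enumeration of differing entries -/

/-- Query the inner products of row `i` of both matrices with the restrictions to `U` of the given
vectors, and report whether some pair of answers differs. -/
noncomputable def differTest (i : Fin n) (U : Fin n → Bool) :
    List (Fin n → Bool) → QueryProg n Bool
  | [] => ret false
  | v :: vs =>
    ask ⟨MatrixName.A, LineKind.row, i, fun j => v j && U j⟩ fun x =>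
      ask ⟨MatrixName.B, LineKind.row, i, fun j => v j && U j⟩ fun y =>
        open Classical in if x = y then differTest i U vs else ret true

lemma cost_differTest_le (i : Fin n) (U : Fin n → Bool) (vs : List (Fin n → Bool)) :
    (differTest i U vs).cost A B ≤ 2 * vs.length := by
  induction vs with
  | nil => simp [differTest]
  | cons v vs ih =>
    simp only [differTest, cost, List.length_cons]
    split_ifs
    · omega
    · simp only [cost_ret]; omega

lemma eval_differTest (i : Fin n) (U : Fin n → Bool) (vs : List (Fin n → Bool)) :
    (differTest i U vs).eval A B = true ↔
      ∃ v ∈ vs, (∑ j, if v j then (if U j then A i j - B i j else 0) else 0) ≠ 0 := by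
  have hdiff : ∀ v : Fin n → Bool,
      (IPQuery.answer A B ⟨MatrixName.A, LineKind.row, i, fun j => v j && U j⟩ =
        IPQuery.answer A B ⟨MatrixName.B, LineKind.row, i, fun j => v j && U j⟩) ↔
      (∑ j, if v j then (if U j then A i j - B i j else 0) else 0) = 0 := by
    intro v
    rw [← sub_eq_zero]
    have : IPQuery.answer A B ⟨MatrixName.A, LineKind.row, i, fun j => v j && U j⟩ -
        IPQuery.answer A B ⟨MatrixName.B, LineKind.row, i, fun j => v j && U j⟩ =
        ∑ j, if v j then (if U j then A i j - B i j else 0) else 0 := by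
      simp only [IPQuery.answer, dotProduct, boolVec, ← Finset.sum_sub_distrib]
      refine Finset.sum_congr rfl fun j _ => ?_
      by_cases hv : v j <;> by_cases hU : U j <;> simp [Matrix.row, hv, hU]
    rw [this]
  induction vs with
  | nil => simp [differTest]
  | cons v vs ih =>
    classical
    have hcons : (differTest i U (v :: vs)).eval A B =
        (if IPQuery.answer A B ⟨MatrixName.A, LineKind.row, i, fun j => v j && U j⟩ =
            IPQuery.answer A B ⟨MatrixName.B, LineKind.row, i, fun j => v j && U j⟩
          then differTest i U vs else ret true).eval A B := by
      simp only [differTest, eval]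
    rw [hcons]
    split_ifs with h
    · refine ih.trans ?_
      simp [(hdiff v).mp h]
    · simpa using Or.inl ((hdiff v).not.mp h)

/-- The part of the set `S` in the interval `[a, b)`. -/
def window (S : Fin n → Bool) (a b : ℕ) : Fin n → Bool :=
  fun j => S j && (decide (a ≤ (j : ℕ)) && decide ((j : ℕ) < b))

/-- The zero tests on row `i` are right for all intervals of `S`. -/
def TestsCorrect (A B : Matrix (Fin n) (Fin n) ℝ) (vs : List (Fin n → Bool)) (i : Fin n)
    (S : Fin n → Bool) : Prop :=
  ∀ a b : ℕ, (differTest i (window S a b) vs).eval A B = true ↔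
    ∃ j : Fin n, S j = true ∧ a ≤ (j : ℕ) ∧ (j : ℕ) < b ∧ A i j ≠ B i j

/-- Bisection for the first column in `S ∩ [a, a + 2 ^ e)` in which the rows `i` differ, which
must exist. -/
noncomputable def findFirst (vs : List (Fin n → Bool)) (i : Fin n) (S : Fin n → Bool) :
    ℕ → ℕ → QueryProg n ℕ
  | 0, a => ret a
  | e + 1, a => (differTest i (window S a (a + 2 ^ e)) vs).bind fun t =>
      if t then findFirst vs i S e a else findFirst vs i S e (a + 2 ^ e)

lemma cost_findFirst_le (vs : List (Fin n → Bool)) (i : Fin n) (S : Fin n → Bool) (e a : ℕ) :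
    (findFirst vs i S e a).cost A B ≤ e * (2 * vs.length) := by
  induction e generalizing a with
  | zero => simp [findFirst]
  | succ e ih =>
    have h := cost_differTest_le (A := A) (B := B) i (window S a (a + 2 ^ e)) vs
    simp only [findFirst, cost_bind, add_mul, one_mul]
    split_ifs
    · have := ih a; omega
    · have := ih (a + 2 ^ e); omega

lemma eval_findFirst {vs : List (Fin n → Bool)} {i : Fin n} {S : Fin n → Bool}
    (hT : TestsCorrect A B vs i S) (e a : ℕ)
    (hex : ∃ j : Fin n, S j = true ∧ a ≤ (j : ℕ) ∧ (j : ℕ) < a + 2 ^ e ∧ A i j ≠ B i j) :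
    ∃ j : Fin n, (findFirst vs i S e a).eval A B = j ∧ S j = true ∧ a ≤ (j : ℕ) ∧
      A i j ≠ B i j ∧
      ∀ j' : Fin n, S j' = true → a ≤ (j' : ℕ) → A i j' ≠ B i j' → j ≤ j' := by
  induction e generalizing a with
  | zero =>
    obtain ⟨j, hS, h1, h2, h3⟩ := hex
    refine ⟨j, ?_, hS, h1, h3, fun j' _ h _ => ?_⟩
    · simp only [findFirst, eval_ret]; omega
    · rw [Fin.le_def]; omega
  | succ e ih =>
    simp only [findFirst, eval_bind]
    split_ifs with ht
    · exact ih a ((hT a (a + 2 ^ e)).mp ht)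
    · have hnone : ∀ j' : Fin n, S j' = true → a ≤ (j' : ℕ) → A i j' ≠ B i j' →
          a + 2 ^ e ≤ (j' : ℕ) := by
        intro j' h1 h2 h3
        by_contra hlt
        exact ht ((hT a (a + 2 ^ e)).mpr ⟨j', h1, h2, by omega, h3⟩)
      obtain ⟨j, hS, h1, h2, h3⟩ := hex
      have hj := hnone j hS h1 h3
      obtain ⟨j₀, g1, g2, g3, g4, g5⟩ :=
        ih (a + 2 ^ e) ⟨j, hS, hj, by rw [pow_succ] at h2; omega, h3⟩
      exact ⟨j₀, g1, g2, by omega, g4, fun j' h1 h2 h3 => g5 j' h1 (hnone j' h1 h2 h3) h3⟩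

/-- Enumerate the first columns `j ∈ S`, `j ≥ a`, in which the rows `i` differ, stopping after
`fuel` of them. The exponent `e` bounds the depth of the bisection. -/
noncomputable def enumerate (vs : List (Fin n → Bool)) (i : Fin n) (S : Fin n → Bool) (e : ℕ) :
    ℕ → ℕ → QueryProg n (Finset (Fin n))
  | 0, _ => ret ∅
  | fuel + 1, a => (differTest i (window S a n) vs).bind fun t =>
      if t then
        (findFirst vs i S e a).bind fun j =>
          (enumerate vs i S e fuel (j + 1)).bind fun F =>
            ret (if h : j < n then insert ⟨j, h⟩ F else F)
      else ret ∅

lemma cost_enumerate_le (vs : List (Fin n → Bool)) (i : Fin n) (S : Fin n → Bool)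
    (e fuel a : ℕ) :
    (enumerate vs i S e fuel a).cost A B ≤ fuel * ((e + 1) * (2 * vs.length)) := by
  induction fuel generalizing a with
  | zero => simp [enumerate]
  | succ fuel ih =>
    have h1 := cost_differTest_le (A := A) (B := B) i (window S a n) vs
    have h2 := cost_findFirst_le (A := A) (B := B) vs i S e a
    simp only [enumerate, cost_bind, add_mul, one_mul]
    split_ifs
    · have := ih ((findFirst vs i S e a).eval A B + 1)
      simp only [add_mul, one_mul, cost_bind, cost_ret] at this ⊢
      omega
    · simp only [cost_ret]; omega

lemma card_eval_enumerate_le (vs : List (Fin n → Bool)) (i : Fin n) (S : Fin n → Bool)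
    (e fuel a : ℕ) : ((enumerate vs i S e fuel a).eval A B).card ≤ fuel := by
  induction fuel generalizing a with
  | zero => simp [enumerate]
  | succ fuel ih =>
    simp only [enumerate, eval_bind]
    split_ifs
    · simp only [eval_bind, eval_ret]
      split_ifs
      · exact (Finset.card_insert_le _ _).trans (Nat.add_le_add_right (ih _) 1)
      · exact (ih _).trans (Nat.le_succ _)
    · simp

lemma eval_enumerate {vs : List (Fin n → Bool)} {i : Fin n} {S : Fin n → Bool}
    (hT : TestsCorrect A B vs i S) {e : ℕ} (he : n ≤ 2 ^ e) (fuel a : ℕ) {P : Finset (Fin n)}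
    (hP : ∀ j, j ∈ P ↔ S j = true ∧ a ≤ (j : ℕ) ∧ A i j ≠ B i j) :
    (enumerate vs i S e fuel a).eval A B ⊆ P ∧
      ((enumerate vs i S e fuel a).eval A B).card = min fuel P.card := by
  induction fuel generalizing a P with
  | zero => simp [enumerate]
  | succ fuel ih =>
    simp only [enumerate, eval_bind]
    split_ifs with ht
    · obtain ⟨j, h1, h2, h3, h4⟩ := (hT a n).mp ht
      obtain ⟨j₀, g1, g2, g3, g4, g5⟩ := eval_findFirst hT e a ⟨j, h1, h2, by omega, h4⟩
      have hj₀ : j₀ ∈ P := (hP j₀).mpr ⟨g2, g3, g4⟩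
      have hP' : ∀ j', j' ∈ P.erase j₀ ↔
          S j' = true ∧ (j₀ : ℕ) + 1 ≤ (j' : ℕ) ∧ A i j' ≠ B i j' := by
        intro j'
        rw [Finset.mem_erase, hP]
        constructor
        · rintro ⟨hne, hS, ha, hd⟩
          have hle := g5 j' hS ha hd
          have : j₀ < j' := lt_of_le_of_ne hle (Ne.symm hne)
          exact ⟨hS, this, hd⟩
        · rintro ⟨hS, ha, hd⟩
          exact ⟨by rintro rfl; omega, hS, by omega, hd⟩
      obtain ⟨k1, k2⟩ := ih ((j₀ : ℕ) + 1) hP'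
      rw [eval_bind, g1, eval_bind, eval_ret, dif_pos j₀.isLt]
      set F := (enumerate vs i S e fuel ((j₀ : ℕ) + 1)).eval A B with hF
      refine ⟨?_, ?_⟩
      · exact Finset.insert_subset hj₀ (k1.trans (Finset.erase_subset _ _))
      · have hnot : j₀ ∉ F := fun h => (Finset.notMem_erase j₀ P) (k1 h)
        have hpos : 0 < P.card := Finset.card_pos.mpr ⟨j₀, hj₀⟩
        rw [Finset.card_insert_of_notMem hnot, k2, Finset.card_erase_of_mem hj₀]
        omega
    · have : P = ∅ := by
        rw [Finset.eq_empty_iff_forall_notMem]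
        intro j hj
        obtain ⟨h1, h2, h3⟩ := (hP j).mp hj
        exact ht ((hT a n).mpr ⟨j, h1, h2, j.isLt, h3⟩)
      simp [this]

end QueryProg

namespace QueryProg

variable {n : ℕ} {A B : Matrix (Fin n) (Fin n) ℝ}

lemma uniformProb_not_testsCorrect_le {L : ℕ} (i : Fin n) (S : Fin n → Bool) :
    uniformProb (fun r : Fin L → Fin n → Bool => ¬ TestsCorrect A B (List.ofFn r) i S) ≤
      (n + 1) ^ 2 * (1 / 2) ^ L := by
  classical
  let x : Fin (n + 1) × Fin (n + 1) → Fin n → ℝ := fun ab j =>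
    if window S ab.1 ab.2 j then A i j - B i j else 0
  have hbad : ∀ r : Fin L → Fin n → Bool, ¬ TestsCorrect A B (List.ofFn r) i S →
      ∃ ab, (∃ j, x ab j ≠ 0) ∧ ∀ l, (∑ j, if r l j then x ab j else 0) = 0 := by
    intro r hr
    by_contra hcon
    push Not at hcon
    refine hr fun a b => ?_
    -- endpoints beyond `n` may be replaced by `n`
    have hwin : window S a b = window S (min a n) (min b n) := by
      ext j
      have hj := j.isLt
      have h1 : (a ≤ (j : ℕ)) ↔ min a n ≤ (j : ℕ) := by omega
      have h2 : ((j : ℕ) < b) ↔ (j : ℕ) < min b n := by omega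
      simp only [window, h1, h2]
    have hx := hcon (⟨min a n, by omega⟩, ⟨min b n, by omega⟩)
    refine (eval_differTest i _ _).trans ?_
    constructor
    · rintro ⟨v, -, hv⟩
      obtain ⟨j, -, hj⟩ := Finset.exists_ne_zero_of_sum_ne_zero hv
      by_cases h1 : v j
      · by_cases h2 : window S a b j
        · rw [if_pos h1, if_pos h2] at hj
          simp only [window, Bool.and_eq_true, decide_eq_true_eq] at h2
          exact ⟨j, h2.1, h2.2.1, h2.2.2, sub_ne_zero.mp hj⟩
        · simp [h2] at hj
      · simp [h1] at hj
    · rintro ⟨j, hS, ha, hb, hne⟩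
      have hw : window S a b j = true := by simp [window, hS, ha, hb]
      obtain ⟨l, hl⟩ := hx ⟨j, by
        simp only [x]
        rw [← hwin, if_pos hw]
        exact sub_ne_zero.mpr hne⟩
      refine ⟨r l, by simp [List.mem_ofFn], ?_⟩
      simp only [x] at hl
      rw [← hwin] at hl
      exact hl
  refine (uniformProb_mono hbad).trans ((uniformProb_exists_le _ (δ := (1 / 2) ^ L) ?_).trans ?_)
  · intro ab
    by_cases hx : ∃ j, x ab j ≠ 0
    · exact (uniformProb_mono fun r h => h.2).trans (uniformProb_forall_sum_eq_zero_le _ hx)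
    · refine (uniformProb_mono (q := fun _ => False) fun r h => hx h.1).trans ?_
      rw [uniformProb_eq]
      simp
  · simp [pow_two]

/-! ### The program for one guess of the distance -/

/-- The indicator of the random set of all points that `f` sends to `0`. -/
def zeroSet {ι : Type*} {s : ℕ} [NeZero s] (f : ι → Fin s) : ι → Bool := fun j => decide (f j = 0)

/-- Decide whether row `i` has at least `K` differing entries in the random set given by `f`. -/
noncomputable def heavyTest {s : ℕ} [NeZero s] (K e : ℕ) (f : Fin n → Fin s)
    (vs : List (Fin n → Bool)) (i : Fin n) : QueryProg n Bool :=
  (enumerate vs i (zeroSet f) e K 0).bind fun F => ret (decide (K ≤ F.card))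

/-- The contribution of row `i` to the estimate: a heavy row contributes nothing, a light row
contributes the number of its differing entries in the random set given by `g`, those in heavy
columns being counted twice. -/
noncomputable def rowSample {s : ℕ} [NeZero s] (K e : ℕ) (f g : Fin n → Fin s)
    (vs : List (Fin n → Bool)) (i : Fin n) : QueryProg n ℝ :=
  (heavyTest K e f vs i).bind fun h =>
    if h then ret 0
    else (enumerate vs i (zeroSet g) e (4 * K) 0).bind fun F =>
      sumList (fun j => (heavyTest K e f vs j).bind fun h => ret (if h then 2 else 1)) F.toList

/-- The estimate of the distance from `T` sampled rows. -/
noncomputable def estimate {s T : ℕ} [NeZero s] (K e : ℕ) (f : Fin n → Fin s)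
    (rows : Fin T → Fin n) (g : Fin T × Fin n → Fin s) (vs : List (Fin n → Bool)) :
    QueryProg n ℝ :=
  (sumList (fun t => rowSample K e f (fun j => g (t, j)) vs (rows t)) (List.finRange T)).bind
    fun x => ret (s * n / T * x)

lemma cost_heavyTest_le {s : ℕ} [NeZero s] (K e : ℕ) (f : Fin n → Fin s)
    (vs : List (Fin n → Bool)) (i : Fin n) :
    (heavyTest K e f vs i).cost A B ≤ K * ((e + 1) * (2 * vs.length)) := by
  simpa [heavyTest] using cost_enumerate_le vs i (zeroSet f) e K 0

lemma cost_rowSample_le {s : ℕ} [NeZero s] (K e : ℕ) (f g : Fin n → Fin s)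
    (vs : List (Fin n → Bool)) (i : Fin n) :
    (rowSample K e f g vs i).cost A B ≤ 9 * K ^ 2 * ((e + 1) * (2 * vs.length)) := by
  set c := (e + 1) * (2 * vs.length) with hc
  have h1 : (heavyTest K e f vs i).cost A B ≤ K * c := cost_heavyTest_le K e f vs i
  have h2 := cost_enumerate_le (A := A) (B := B) vs i (zeroSet g) e (4 * K) 0
  have h3 := card_eval_enumerate_le (A := A) (B := B) vs i (zeroSet g) e (4 * K) 0
  have hcost : ∀ j, ((heavyTest K e f vs j).bind fun h =>
      (ret (if h then 2 else 1) : QueryProg n ℝ)).cost A B ≤ K * c := by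
    intro j
    simpa using cost_heavyTest_le (A := A) (B := B) K e f vs j
  have h4 := cost_sumList_le hcost
    ((enumerate vs i (zeroSet g) e (4 * K) 0).eval A B).toList
  rw [Finset.length_toList] at h4
  have h5 := Nat.mul_le_mul_right (K * c) h3
  have h6 : K * c ≤ K ^ 2 * c := Nat.mul_le_mul_right c (Nat.le_self_pow two_ne_zero K)
  simp only [rowSample, cost_bind]
  split_ifs
  · simp only [cost_ret]
    nlinarith
  · simp only [cost_bind]
    nlinarith

lemma cost_estimate_le {s T : ℕ} [NeZero s] (K e : ℕ) (f : Fin n → Fin s)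
    (rows : Fin T → Fin n) (g : Fin T × Fin n → Fin s) (vs : List (Fin n → Bool)) :
    (estimate K e f rows g vs).cost A B ≤
      T * (9 * K ^ 2 * ((e + 1) * (2 * vs.length))) := by
  have := cost_sumList_le
    (p := fun t => rowSample K e f (fun j => g (t, j)) vs (rows t))
    (fun t => cost_rowSample_le (A := A) (B := B) K e f (fun j => g (t, j)) vs (rows t))
    (List.finRange T)
  simpa [estimate] using this

end QueryProg

/-- The set of columns in which row `i` of `A` differs from row `i` of `B`. -/
noncomputable def differSet {n : ℕ} (A B : Matrix (Fin n) (Fin n) ℝ) (i : Fin n) :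
    Finset (Fin n) :=
  Finset.univ.filter fun j => A i j ≠ B i j

lemma matrixDist_eq_sum {n : ℕ} (A B : Matrix (Fin n) (Fin n) ℝ) :
    matrixDist A B = ∑ i, (differSet A B i).card := by
  classical
  unfold matrixDist differSet
  rw [Finset.card_filter, Fintype.sum_prod_type]
  simp only [Finset.card_filter]

/-- The points of `N` that the function `f` sends to `0`. -/
def hits {ι : Type*} {s : ℕ} [NeZero s] (N : Finset ι) (f : ι → Fin s) : Finset ι :=
  N.filter fun j => f j = 0

/-- The points `i` for which `f` hits the set `N i` at least `K` times. -/
def heavySet {n s : ℕ} [NeZero s] (N : Fin n → Finset (Fin n)) (K : ℕ) (f : Fin n → Fin s) :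
    Finset (Fin n) :=
  Finset.univ.filter fun i => K ≤ (hits (N i) f).card

/-- The weight of the entry `j` of a light row: entries in heavy columns count twice, to make up
for their mirror images in heavy rows. -/
def entryWeight {n : ℕ} (H : Finset (Fin n)) (j : Fin n) : ℝ := if j ∈ H then 2 else 1

/-- The total weight of row `i`; heavy rows have weight zero. -/
def rowWeight {n : ℕ} (N : Fin n → Finset (Fin n)) (H : Finset (Fin n)) (i : Fin n) : ℝ :=
  if i ∈ H then 0 else ∑ j ∈ N i, entryWeight H j

namespace QueryProg

variable {n : ℕ} {A B : Matrix (Fin n) (Fin n) ℝ}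

lemma mem_hits_differSet {s : ℕ} [NeZero s] (f : Fin n → Fin s) (i j : Fin n) :
    j ∈ hits (differSet A B i) f ↔ zeroSet f j = true ∧ 0 ≤ (j : ℕ) ∧ A i j ≠ B i j := by
  unfold hits differSet zeroSet
  simp only [Finset.mem_filter, Finset.mem_univ, true_and, decide_eq_true_eq, zero_le]
  exact and_comm

lemma eval_heavyTest {s : ℕ} [NeZero s] {K e : ℕ} (he : n ≤ 2 ^ e) {f : Fin n → Fin s}
    {vs : List (Fin n → Bool)} {i : Fin n} (hT : TestsCorrect A B vs i (zeroSet f)) :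
    (heavyTest K e f vs i).eval A B = decide (i ∈ heavySet (differSet A B) K f) := by
  obtain ⟨-, h⟩ := eval_enumerate hT he K 0 (P := hits (differSet A B i) f)
    fun j => mem_hits_differSet f i j
  simp only [heavyTest, eval_bind, eval_ret, h, heavySet, Finset.mem_filter, Finset.mem_univ,
    true_and]
  congr 1
  simp

/-- With correct zero tests, and if no light row is hit so often that its enumeration is cut off,
the program computes the weighted count of the hits in the light sampled rows. -/
lemma eval_estimate {s T : ℕ} [NeZero s] {K e : ℕ} (he : n ≤ 2 ^ e) {f : Fin n → Fin s}
    {rows : Fin T → Fin n} {g : Fin T × Fin n → Fin s} {vs : List (Fin n → Bool)}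
    (hf : ∀ i, TestsCorrect A B vs i (zeroSet f))
    (hg : ∀ t i, TestsCorrect A B vs i (zeroSet fun j => g (t, j)))
    (hcut : ∀ t, rows t ∉ heavySet (differSet A B) K f →
      (hits (differSet A B (rows t)) fun j => g (t, j)).card < 4 * K) :
    (estimate K e f rows g vs).eval A B =
      s * n / T * ∑ t, if rows t ∈ heavySet (differSet A B) K f then 0 else
        ∑ j ∈ hits (differSet A B (rows t)) (fun j => g (t, j)),
          entryWeight (heavySet (differSet A B) K f) j := by
  simp only [estimate, eval_bind, eval_ret, eval_sumList]
  congr 1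
  rw [← Fin.sum_univ_def]
  refine Finset.sum_congr rfl fun t _ => ?_
  simp only [rowSample, eval_bind, eval_heavyTest he (hf _)]
  by_cases h : rows t ∈ heavySet (differSet A B) K f
  · simp [h]
  · obtain ⟨h1, h2⟩ := eval_enumerate (hg t (rows t)) he (4 * K) 0
      (P := hits (differSet A B (rows t)) fun j => g (t, j))
      fun j => mem_hits_differSet _ _ j
    have h3 := Finset.eq_of_subset_of_card_le h1 (by rw [h2]; exact (le_min (hcut t h).le le_rfl))
    simp [h, h3, eval_heavyTest he (hf _), entryWeight]

end QueryProg

/-! ### Concentration for one guess of the distance -/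

section Concentration

/-- The number of hits of a set in a random subsample of density `1 / s`. -/
lemma uniformProb_card_hits {ι : Type*} [Fintype ι] [DecidableEq ι] {s : ℕ} [NeZero s]
    (N : Finset ι) {K : ℝ} :
    uniformProb (fun f : ι → Fin s =>
        1 / 2 * max ((N.card : ℝ) / s) (K / 2) < |((hits N f).card : ℝ) - N.card / s|) ≤
      2 * Real.exp (-(K / 32)) := by
  have hsum : ∑ i, (if i ∈ N then (1 : ℝ) else 0) = N.card := by simp
  have hhits : ∀ f : ι → Fin s, (∑ i, if f i = 0 then (if i ∈ N then (1 : ℝ) else 0) else 0) =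
      (hits N f).card := by
    intro f
    simp only [← ite_and]
    rw [Finset.sum_boole]
    refine congrArg (fun F : Finset ι => (F.card : ℝ)) ?_
    ext i
    simp [hits, and_comm]
  have h := uniformProb_chernoff_subsample (s := s) (w := fun i => if i ∈ N then (1 : ℝ) else 0)
    (fun i => by split_ifs <;> simp) (fun i => by split_ifs <;> simp)
    (a := max ((N.card : ℝ) / s) (K / 2)) (ε := 1 / 2) (by rw [hsum]; exact le_max_left _ _)
    (by norm_num) (by norm_num)
  simp only [hhits, hsum] at h
  have hmax := le_max_right ((N.card : ℝ) / s) (K / 2)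
  have hexp : -((1 / 2) ^ 2 * max ((N.card : ℝ) / s) (K / 2) / 4) ≤ -(K / 32) := by linarith
  linarith [Real.exp_le_exp.mpr hexp]

/-- The sum of a bounded nonnegative function over `T` random points. -/
lemma uniformProb_sum_sample {n T : ℕ} [NeZero n] {W : Fin n → ℝ} {b M ε : ℝ} (hb : 0 < b)
    (h0 : ∀ i, 0 ≤ W i) (h1 : ∀ i, W i ≤ b) (hM : ∑ i, W i ≤ M) (hε0 : 0 < ε) (hε1 : ε ≤ 1) :
    uniformProb (fun rows : Fin T → Fin n =>
        ε * (T * M / n) < |∑ t, W (rows t) - T * (∑ i, W i) / n|) ≤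
      2 * Real.exp (-(ε ^ 2 * (T * M / (b * n)) / 4)) := by
  have hn : (0 : ℝ) < n := by exact_mod_cast Nat.pos_of_ne_zero (NeZero.ne n)
  have h := uniformProb_chernoff (ι := Fin T) (Ω := Fin n) (X := fun _ i => W i / b)
    (fun _ i => div_nonneg (h0 i) hb.le) (fun _ i => (div_le_one hb).mpr (h1 i))
    (μ := T * (∑ i, W i) / (b * n)) (a := T * M / (b * n)) (ε := ε)
    (by
      simp only [← Finset.sum_div, Finset.sum_const, Finset.card_univ, Fintype.card_fin,
        nsmul_eq_mul]
      field_simp)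
    (by gcongr) hε0 hε1
  refine (uniformProb_mono fun rows hr => ?_).trans h
  have e1 : ∑ t, W (rows t) / b - T * (∑ i, W i) / (b * n) =
      (∑ t, W (rows t) - T * (∑ i, W i) / n) / b := by
    rw [← Finset.sum_div]
    field_simp
  rw [e1, abs_div, abs_of_pos hb, lt_div_iff₀ hb]
  calc ε * (T * M / (b * n)) * b = ε * (T * M / n) := by field_simp
    _ < _ := hr

variable {n s : ℕ} [NeZero s] {N : Fin n → Finset (Fin n)}

/-- Every row is hit as often as expected, up to a relative error of one half or an additive error
of `K / 4`, whichever is larger. -/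
def HitsConcentrated (N : Fin n → Finset (Fin n)) (K : ℕ) (f : Fin n → Fin s) : Prop :=
  ∀ i, |((hits (N i) f).card : ℝ) - (N i).card / s| ≤
    1 / 2 * max (((N i).card : ℝ) / s) ((K : ℝ) / 2)

lemma uniformProb_not_hitsConcentrated (N : Fin n → Finset (Fin n)) (K : ℕ) :
    uniformProb (fun f : Fin n → Fin s => ¬ HitsConcentrated N K f) ≤
      n * (2 * Real.exp (-((K : ℝ) / 32))) := by
  refine (uniformProb_mono fun f hf => ?_).trans ((uniformProb_exists_le
    (fun i (f : Fin n → Fin s) => 1 / 2 * max (((N i).card : ℝ) / s) ((K : ℝ) / 2) <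
      |((hits (N i) f).card : ℝ) - (N i).card / s|)
    fun i => uniformProb_card_hits (N i)).trans_eq (by simp))
  simpa [HitsConcentrated] using hf

lemma uniformProb_exists_not_hitsConcentrated {T : ℕ} (N : Fin n → Finset (Fin n)) (K : ℕ) :
    uniformProb (fun g : Fin T × Fin n → Fin s =>
        ∃ t, ¬ HitsConcentrated N K fun j => g (t, j)) ≤
      T * n * (2 * Real.exp (-((K : ℝ) / 32))) := by
  have hcard : ∀ (t : Fin T) (i : Fin n) (g : Fin T × Fin n → Fin s),
      (hits ((N i).map (Function.Embedding.sectR t (Fin n))) g).card =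
        (hits (N i) fun j => g (t, j)).card := by
    intro t i g
    unfold hits
    rw [Finset.filter_map, Finset.card_map]
    rfl
  have h := uniformProb_exists_le
    (fun (k : Fin T × Fin n) (g : Fin T × Fin n → Fin s) =>
      1 / 2 * max (((N k.2).card : ℝ) / s) ((K : ℝ) / 2) <
        |((hits (N k.2) fun j => g (k.1, j)).card : ℝ) - (N k.2).card / s|)
    (δ := 2 * Real.exp (-((K : ℝ) / 32)))
    fun k => by
      simpa only [hcard, Finset.card_map] using
        uniformProb_card_hits (s := s) ((N k.2).map (Function.Embedding.sectR k.1 (Fin n)))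
          (K := K)
  refine (uniformProb_mono fun g hg => ?_).trans (h.trans_eq (by simp))
  obtain ⟨t, ht⟩ := hg
  simp only [HitsConcentrated, not_forall, not_le] at ht
  obtain ⟨i, hi⟩ := ht
  exact ⟨(t, i), hi⟩

lemma card_lt_of_notMem_heavySet {K : ℕ} {f : Fin n → Fin s} (hf : HitsConcentrated N K f)
    {i : Fin n} (hi : i ∉ heavySet N K f) : ((N i).card : ℝ) / s < 2 * K := by
  have hlt : ((hits (N i) f).card : ℝ) < K := by
    exact_mod_cast (by simpa [heavySet] using hi : (hits (N i) f).card < K)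
  by_contra hge
  push Not at hge
  have h := (abs_le.mp (hf i)).1
  have hK : (0 : ℝ) ≤ K := K.cast_nonneg
  rw [max_eq_left (by linarith)] at h
  linarith

lemma lt_card_of_mem_heavySet {K : ℕ} (hK : 0 < K) {f : Fin n → Fin s}
    (hf : HitsConcentrated N K f) {i : Fin n} (hi : i ∈ heavySet N K f) :
    (K : ℝ) / 4 < ((N i).card : ℝ) / s := by
  have hle : (K : ℝ) ≤ (hits (N i) f).card := by
    exact_mod_cast (by simpa [heavySet] using hi : K ≤ (hits (N i) f).card)
  by_contra hge
  push Not at hge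
  have h := (abs_le.mp (hf i)).2
  have hK' : (0 : ℝ) < K := by exact_mod_cast hK
  rw [max_eq_right (by linarith)] at h
  linarith

lemma card_hits_lt_of_card_lt {K : ℕ} (hK : 0 < K) {f : Fin n → Fin s}
    (hf : HitsConcentrated N K f) {i : Fin n} (hi : ((N i).card : ℝ) / s < 2 * K) :
    (hits (N i) f).card < 4 * K := by
  have h := (abs_le.mp (hf i)).2
  have hK' : (0 : ℝ) < K := by exact_mod_cast hK
  have hmax : max (((N i).card : ℝ) / s) ((K : ℝ) / 2) ≤ 2 * K := max_le hi.le (by linarith)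
  have : ((hits (N i) f).card : ℝ) < 4 * K := by linarith
  exact_mod_cast this

end Concentration

/-! ### Row weights of a symmetric pattern -/

section Weights

variable {n : ℕ}

lemma entryWeight_pos (H : Finset (Fin n)) (j : Fin n) : 0 < entryWeight H j := by
  unfold entryWeight; split_ifs <;> norm_num

lemma entryWeight_le_two (H : Finset (Fin n)) (j : Fin n) : entryWeight H j ≤ 2 := by
  unfold entryWeight; split_ifs <;> norm_num

lemma rowWeight_nonneg (N : Fin n → Finset (Fin n)) (H : Finset (Fin n)) (i : Fin n) :
    0 ≤ rowWeight N H i := by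
  unfold rowWeight
  split_ifs
  · rfl
  · exact Finset.sum_nonneg fun j _ => (entryWeight_pos H j).le

lemma rowWeight_le (N : Fin n → Finset (Fin n)) {H : Finset (Fin n)} {i : Fin n} {b : ℝ}
    (hb : 0 ≤ b) (h : i ∉ H → ((N i).card : ℝ) ≤ b) : rowWeight N H i ≤ 2 * b := by
  unfold rowWeight
  split_ifs with hi
  · linarith
  · calc ∑ j ∈ N i, entryWeight H j ≤ ∑ _j ∈ N i, (2 : ℝ) :=
          Finset.sum_le_sum fun j _ => entryWeight_le_two H j
      _ = 2 * (N i).card := by simp [mul_comm]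
      _ ≤ 2 * b := by linarith [h hi]

/-- By symmetry every entry of a heavy row in a light column is accounted for by its mirror image;
only the entries in heavy rows and heavy columns are missed. -/
lemma sum_rowWeight_bounds {N : Fin n → Finset (Fin n)} (hN : ∀ i j, j ∈ N i ↔ i ∈ N j)
    (H : Finset (Fin n)) :
    ∑ i, rowWeight N H i ≤ ∑ i, ((N i).card : ℝ) ∧
      ∑ i, ((N i).card : ℝ) ≤ ∑ i, rowWeight N H i + (H.card : ℝ) ^ 2 := by
  classical
  let a : Fin n → Fin n → ℝ := fun i j => if j ∈ N i then 1 else 0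
  let h : Fin n → ℝ := fun i => if i ∈ H then 1 else 0
  have ha : ∀ i j, a i j = a j i := fun i j => by simp only [a, hN i j]
  have hcard : ∀ i, ((N i).card : ℝ) = ∑ j, a i j := fun i => by simp [a]
  have hrow : ∀ i, rowWeight N H i = ∑ j, a i j * ((1 - h i) * (1 + h j)) := by
    intro i
    by_cases hi : i ∈ H
    · simp [rowWeight, hi, h]
    · have : ∀ j, a i j * ((1 - h i) * (1 + h j)) = if j ∈ N i then entryWeight H j else 0 := by
        intro j
        by_cases hj : j ∈ H <;> simp [a, h, hi, hj, entryWeight]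
        norm_num
      simp only [this, rowWeight, if_neg hi]
      simp
  have hswap : ∑ i, ∑ j, a i j * h i = ∑ i, ∑ j, a i j * h j := by
    rw [Finset.sum_comm]
    exact Finset.sum_congr rfl fun i _ => Finset.sum_congr rfl fun j _ => by rw [ha]
  have hsum : ∑ i, rowWeight N H i =
      ∑ i, ((N i).card : ℝ) - ∑ i, ∑ j, a i j * (h i * h j) := by
    calc ∑ i, rowWeight N H i
        = ∑ i, ∑ j, (a i j - a i j * h i + a i j * h j - a i j * (h i * h j)) := by
          refine Finset.sum_congr rfl fun i _ => ?_
          rw [hrow]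
          exact Finset.sum_congr rfl fun j _ => by ring
      _ = _ := by
          simp only [Finset.sum_sub_distrib, Finset.sum_add_distrib, hswap, hcard]
          ring
  have ha01 : ∀ i j, 0 ≤ a i j ∧ a i j ≤ 1 := fun i j => by
    simp only [a]; split_ifs <;> norm_num
  have hh0 : ∀ i, 0 ≤ h i := fun i => by simp only [h]; split_ifs <;> norm_num
  have hmiss0 : 0 ≤ ∑ i, ∑ j, a i j * (h i * h j) :=
    Finset.sum_nonneg fun i _ => Finset.sum_nonneg fun j _ =>
      mul_nonneg (ha01 i j).1 (mul_nonneg (hh0 i) (hh0 j))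
  have hmiss1 : ∑ i, ∑ j, a i j * (h i * h j) ≤ (H.card : ℝ) ^ 2 := by
    have hHs : ∑ i, h i = H.card := by simp [h]
    rw [pow_two, ← hHs, Finset.sum_mul_sum]
    exact Finset.sum_le_sum fun i _ => Finset.sum_le_sum fun j _ =>
      mul_le_of_le_one_left (mul_nonneg (hh0 i) (hh0 j)) (ha01 i j).2
  constructor <;> linarith

/-- If all heavy rows have more than `K s / 4` entries and there are at most `s ^ 2` entries in
total, then few entries lie in heavy rows and heavy columns. -/
lemma sq_card_heavy_le {N : Fin n → Finset (Fin n)} {H : Finset (Fin n)} {K s : ℝ} (hK : 0 < K)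
    (hs : 0 < s) (hH : ∀ i ∈ H, K / 4 < ((N i).card : ℝ) / s)
    (hD : ∑ i, ((N i).card : ℝ) ≤ s ^ 2) :
    (H.card : ℝ) ^ 2 * K ^ 2 ≤ 16 * ∑ i, ((N i).card : ℝ) := by
  set D : ℝ := ∑ i, ((N i).card : ℝ) with hDdef
  have hD0 : 0 ≤ D := Finset.sum_nonneg fun i _ => Nat.cast_nonneg _
  have h1 : (H.card : ℝ) * (K * s) ≤ 4 * D := by
    calc (H.card : ℝ) * (K * s) = ∑ _i ∈ H, K * s := by simp
      _ ≤ ∑ i ∈ H, 4 * ((N i).card : ℝ) := by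
          refine Finset.sum_le_sum fun i hi => ?_
          have := hH i hi
          rw [lt_div_iff₀ hs] at this
          linarith
      _ ≤ ∑ i, 4 * ((N i).card : ℝ) :=
          Finset.sum_le_sum_of_subset_of_nonneg (Finset.subset_univ _)
            fun i _ _ => by positivity
      _ = 4 * D := by rw [← Finset.mul_sum]
  have h2 : ((H.card : ℝ) * (K * s)) ^ 2 ≤ (4 * D) ^ 2 := by gcongr
  have h3 : D ^ 2 ≤ D * s ^ 2 := by nlinarith
  have h4 : (H.card : ℝ) ^ 2 * K ^ 2 * s ^ 2 ≤ 16 * D * s ^ 2 := by nlinarith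
  exact le_of_mul_le_mul_right h4 (by positivity)

/-- The weighted count of hits in the sampled rows is concentrated around its mean. -/
lemma uniformProb_sum_hits {s T : ℕ} [NeZero s] (N : Fin n → Finset (Fin n))
    (H : Finset (Fin n)) (rows : Fin T → Fin n) {a ε : ℝ}
    (ha : (∑ t, rowWeight N H (rows t)) / (2 * s) ≤ a) (hε0 : 0 < ε) (hε1 : ε ≤ 1) :
    uniformProb (fun g : Fin T × Fin n → Fin s =>
        2 * ε * a < |(∑ t, if rows t ∈ H then 0 else
          ∑ j ∈ hits (N (rows t)) (fun j => g (t, j)), entryWeight H j) -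
            (∑ t, rowWeight N H (rows t)) / s|) ≤
      2 * Real.exp (-(ε ^ 2 * a / 4)) := by
  classical
  let w : Fin T × Fin n → ℝ := fun k =>
    if rows k.1 ∈ H then 0 else if k.2 ∈ N (rows k.1) then entryWeight H k.2 / 2 else 0
  have hw0 : ∀ k, 0 ≤ w k := fun k => by
    simp only [w]
    split_ifs
    · rfl
    · linarith [entryWeight_pos H k.2]
    · rfl
  have hw1 : ∀ k, w k ≤ 1 := fun k => by
    simp only [w]
    split_ifs
    · norm_num
    · linarith [entryWeight_le_two H k.2]
    · norm_num
  have hsum : ∑ k, w k = (∑ t, rowWeight N H (rows t)) / 2 := by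
    rw [Fintype.sum_prod_type, Finset.sum_div]
    refine Finset.sum_congr rfl fun t _ => ?_
    by_cases ht : rows t ∈ H
    · simp [w, rowWeight, ht]
    · simp [w, rowWeight, ht, Finset.sum_div]
  have hhit : ∀ g : Fin T × Fin n → Fin s, (∑ k, if g k = 0 then w k else 0) =
      (∑ t, if rows t ∈ H then 0 else
        ∑ j ∈ hits (N (rows t)) (fun j => g (t, j)), entryWeight H j) / 2 := by
    intro g
    rw [Fintype.sum_prod_type, Finset.sum_div]
    refine Finset.sum_congr rfl fun t _ => ?_
    by_cases ht : rows t ∈ H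
    · simp [w, ht]
    · simp only [w, if_neg ht, hits, Finset.sum_div, Finset.sum_filter]
      rw [← Finset.sum_subset (Finset.subset_univ (N (rows t)))
        fun j _ hj => by simp [hj]]
      exact Finset.sum_congr rfl fun j hj => by simp [hj, ite_div]
  have h := uniformProb_chernoff_subsample (s := s) hw0 hw1 (a := a) (ε := ε)
    (by rw [hsum, div_div]; exact ha) hε0 hε1
  refine (uniformProb_mono fun g hg => ?_).trans h
  rw [hhit, hsum, div_right_comm, ← sub_div, abs_div, abs_two]
  linarith

end Weights

/-! ### Failure probability for one guess of the distance -/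

/-- Draw all random choices for one guess, compute the estimate and pass it to `next`. -/
noncomputable def guessAlg {n : ℕ} [NeZero n] (s T K L e : ℕ) [NeZero s]
    (next : ℝ → IPAlgorithm n) : IPAlgorithm n :=
  IPAlgorithm.drawFrom (Fin n → Fin s) fun f =>
    IPAlgorithm.drawFrom (Fin T → Fin n) fun rows =>
      IPAlgorithm.drawFrom (Fin T × Fin n → Fin s) fun g =>
        IPAlgorithm.drawFrom (Fin L → Fin n → Bool) fun r =>
          (QueryProg.estimate K e f rows g (List.ofFn r)).thenAlg next

/-- The three sources of error of the estimate: entries in heavy rows and columns, sampling of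
rows, and sampling of columns. -/
lemma abs_scaled_sub_le {ε D D' M T n s R Y : ℝ} (hT : 0 < T) (hn : 0 < n) (hs : 0 < s)
    (h0 : D' ≤ D) (h1 : D - D' ≤ ε / 4 * M) (h2 : |R - T * D' / n| ≤ ε / 4 * (T * M / n))
    (h3 : |Y - R / s| ≤ 2 * (ε / 8) * (T * M / (n * s))) :
    |s * n / T * Y - D| ≤ ε * M := by
  have e : s * n / T * Y - D =
      s * n / T * (Y - R / s) + n / T * (R - T * D' / n) - (D - D') := by
    field_simp
    ring
  have k1 : |s * n / T * (Y - R / s)| ≤ ε / 4 * M := by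
    rw [abs_mul, abs_of_pos (by positivity)]
    calc s * n / T * |Y - R / s| ≤ s * n / T * (2 * (ε / 8) * (T * M / (n * s))) := by gcongr
      _ = ε / 4 * M := by field_simp; ring
  have k2 : |n / T * (R - T * D' / n)| ≤ ε / 4 * M := by
    rw [abs_mul, abs_of_pos (by positivity)]
    calc n / T * |R - T * D' / n| ≤ n / T * (ε / 4 * (T * M / n)) := by gcongr
      _ = ε / 4 * M := by field_simp
  rw [e]
  rw [abs_le] at k1 k2 ⊢
  constructor <;> linarith [k1.1, k1.2, k2.1, k2.2]

lemma mem_differSet_comm {n : ℕ} {A B : Matrix (Fin n) (Fin n) ℝ} (hA : A.IsSymm)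
    (hB : B.IsSymm) (i j : Fin n) : j ∈ differSet A B i ↔ i ∈ differSet A B j := by
  simp only [differSet, Finset.mem_filter, Finset.mem_univ, true_and]
  rw [hA.apply i j, hB.apply i j]

/-- If no light sampled row is cut off, then random test vectors make the estimate equal to the
weighted count of the hits, except with small probability. -/
lemma prob_drawFrom_estimate_le {n : ℕ} {A B : Matrix (Fin n) (Fin n) ℝ} {s T K L e : ℕ}
    [NeZero s] (he : n ≤ 2 ^ e) (f : Fin n → Fin s) (rows : Fin T → Fin n)
    (g : Fin T × Fin n → Fin s)
    (hcut : ∀ t, rows t ∉ heavySet (differSet A B) K f →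
      (hits (differSet A B (rows t)) fun j => g (t, j)).card < 4 * K)
    {next : ℝ → IPAlgorithm n} {E : ℝ → ℕ → Prop} {δ : ℝ} (hδ : 0 ≤ δ)
    (hnext : ∀ q : ℕ, q ≤ T * (9 * K ^ 2 * ((e + 1) * (2 * L))) →
      (next (s * n / T * ∑ t, if rows t ∈ heavySet (differSet A B) K f then 0 else
        ∑ j ∈ hits (differSet A B (rows t)) (fun j => g (t, j)),
          entryWeight (heavySet (differSet A B) K f) j)).prob A B (fun d c => E d (c + q)) ≤ δ) :
    (IPAlgorithm.drawFrom (Fin L → Fin n → Bool) fun r =>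
        (QueryProg.estimate K e f rows g (List.ofFn r)).thenAlg next).prob A B E ≤
      (T + 1) * n * ((n + 1) ^ 2 * (1 / 2) ^ L) + δ := by
  let S : Option (Fin T) → Fin n → Bool := fun o =>
    o.elim (QueryProg.zeroSet f) fun t => QueryProg.zeroSet fun j => g (t, j)
  let bad : Option (Fin T) × Fin n → (Fin L → Fin n → Bool) → Prop := fun k r =>
    ¬ QueryProg.TestsCorrect A B (List.ofFn r) k.2 (S k.1)
  have hbad : uniformProb (fun r => ∃ k, bad k r) ≤
      (T + 1) * n * ((n + 1) ^ 2 * (1 / 2) ^ L) := by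
    have h := uniformProb_exists_le bad (δ := (n + 1) ^ 2 * (1 / 2) ^ L) fun k =>
      QueryProg.uniformProb_not_testsCorrect_le k.2 (S k.1)
    have hcard : (Fintype.card (Option (Fin T) × Fin n) : ℝ) = (T + 1) * n := by simp
    rwa [hcard] at h
  refine IPAlgorithm.prob_drawFrom_le hδ hbad fun r hr => ?_
  simp only [bad] at hr
  push Not at hr
  rw [QueryProg.prob_thenAlg,
    QueryProg.eval_estimate he (fun i => hr (none, i)) (fun t i => hr (some t, i)) hcut]
  refine hnext _ ((QueryProg.cost_estimate_le K e f rows g (List.ofFn r)).trans_eq ?_)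
  rw [List.length_ofFn]

/-- The accuracy `1 / ε ≤ Q` and the sample size enter the exponents through this bound. -/
lemma sample_size_bound {Q T n s ε M : ℝ} (hn : 0 ≤ n) (hs : 0 ≤ s) (hT : 0 ≤ T)
    (hQε : 1 ≤ Q * ε) (hTs : 2 ^ 19 * Q ^ 4 * n ≤ T * s) (hsM : s ^ 2 / 16 ≤ M) :
    2 ^ 15 * Q ^ 2 * n * s ≤ ε ^ 2 * (T * M) := by
  have hQsq : 1 ≤ Q ^ 2 * ε ^ 2 := by
    rw [← mul_pow]
    exact one_le_pow₀ hQε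
  calc 2 ^ 15 * Q ^ 2 * n * s ≤ 2 ^ 15 * Q ^ 2 * n * s * (Q ^ 2 * ε ^ 2) :=
        le_mul_of_one_le_right (by positivity) hQsq
    _ = 2 ^ 19 * Q ^ 4 * n * (s * ε ^ 2 / 16) := by ring
    _ ≤ T * s * (s * ε ^ 2 / 16) := by gcongr
    _ = ε ^ 2 * (T * (s ^ 2 / 16)) := by ring
    _ ≤ ε ^ 2 * (T * M) := by gcongr

/-- If the distance is at most `s ^ 2`, then the estimate for the guess `s ^ 2` has error at most
`ε * max D (s ^ 2 / 16)`, except with small probability. -/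
lemma prob_guessAlg_le {n : ℕ} [NeZero n] {A B : Matrix (Fin n) (Fin n) ℝ} (hA : A.IsSymm)
    (hB : B.IsSymm) {s T Q e : ℕ} [NeZero s] (he : n ≤ 2 ^ e) {ε : ℝ} (hε0 : 0 < ε)
    (hε1 : ε < 1 / 2) (hQ : 1 / ε ≤ Q) (hT : 2 ^ 19 * Q ^ 4 * n ≤ T * s)
    (hD : (matrixDist A B : ℝ) ≤ (s : ℝ) ^ 2) {next : ℝ → IPAlgorithm n} {E : ℝ → ℕ → Prop}
    {δ : ℝ} (hδ : 0 ≤ δ)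
    (hnext : ∀ (x : ℝ) (q : ℕ),
      |x - matrixDist A B| ≤ ε * max (matrixDist A B : ℝ) ((s : ℝ) ^ 2 / 16) →
      q ≤ T * (9 * (64 * Q) ^ 2 * ((e + 1) * (2 * (4 * Q)))) →
      (next x).prob A B (fun d c => E d (c + q)) ≤ δ) :
    (guessAlg s T (64 * Q) (4 * Q) e next).prob A B E ≤
      n * (2 * Real.exp (-(2 * Q))) + (2 * Real.exp (-(2 * Q)) +
        ((2 * Real.exp (-(2 * Q)) + T * n * (2 * Real.exp (-(2 * Q)))) +
          ((T + 1) * n * ((n + 1) ^ 2 * (1 / 2) ^ (4 * Q)) + δ))) := by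
  set N := differSet A B with hNdef
  set D : ℝ := (matrixDist A B : ℝ) with hDdef
  set M : ℝ := max D ((s : ℝ) ^ 2 / 16) with hMdef
  have hn : (0 : ℝ) < n := by exact_mod_cast Nat.pos_of_ne_zero (NeZero.ne n)
  have hs : (0 : ℝ) < s := by exact_mod_cast Nat.pos_of_ne_zero (NeZero.ne s)
  have hQ2 : (2 : ℝ) ≤ Q := by
    have : (2 : ℝ) ≤ 1 / ε := by rw [le_div_iff₀ hε0]; linarith
    linarith
  have hQ0 : 0 < 64 * Q := by
    have : 0 < Q := by exact_mod_cast (by linarith : (0 : ℝ) < Q)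
    omega
  have hQε : 1 ≤ Q * ε := by rwa [div_le_iff₀ hε0] at hQ
  have hTs : (2 : ℝ) ^ 19 * Q ^ 4 * n ≤ T * s := by exact_mod_cast hT
  have hT0 : (0 : ℝ) < T := by
    by_contra hcon
    have : (T : ℝ) = 0 := le_antisymm (not_lt.mp hcon) T.cast_nonneg
    rw [this, zero_mul] at hTs
    have : (0 : ℝ) < 2 ^ 19 * Q ^ 4 * n := by positivity
    linarith
  have hM0 : 0 < M := lt_of_lt_of_le (by positivity) (le_max_right D ((s : ℝ) ^ 2 / 16))
  have hsM : (s : ℝ) ^ 2 / 16 ≤ M := le_max_right _ _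
  have hDM : D ≤ M := le_max_left _ _
  have hDsum : D = ∑ i, ((N i).card : ℝ) := by
    rw [hDdef, matrixDist_eq_sum]
    push_cast
    rfl
  have hexpK : Real.exp (-(((64 * Q : ℕ) : ℝ) / 32)) = Real.exp (-(2 * Q)) := by
    congr 1
    push_cast
    ring
  have hTM' : (2 : ℝ) ^ 15 * Q ^ 2 * n * s ≤ ε ^ 2 * (T * M) :=
    sample_size_bound hn.le hs.le hT0.le hQε hTs hsM
  refine IPAlgorithm.prob_drawFrom_le (bad := fun f => ¬ HitsConcentrated N (64 * Q) f)
    (by positivity) ((uniformProb_not_hitsConcentrated N (64 * Q)).trans_eq (by rw [hexpK]))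
    fun f hf => ?_
  rw [not_not] at hf
  set H := heavySet N (64 * Q) f with hHdef
  set W := rowWeight N H with hWdef
  obtain ⟨hW1, hW2⟩ := sum_rowWeight_bounds (mem_differSet_comm hA hB) H
  rw [← hNdef, ← hDsum, ← hWdef] at hW1 hW2
  have hheavy : (H.card : ℝ) ^ 2 ≤ ε / 4 * M := by
    have h1 := sq_card_heavy_le (K := ((64 * Q : ℕ) : ℝ)) (by exact_mod_cast hQ0) hs
      (fun i hi => lt_card_of_mem_heavySet hQ0 hf hi) (by rw [← hDsum]; exact hD)
    rw [← hDsum] at h1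
    push_cast at h1
    have hc : (0 : ℝ) ≤ (H.card : ℝ) ^ 2 := by positivity
    have h2 : (H.card : ℝ) ^ 2 * (256 * Q) ≤ D := by nlinarith
    have h3 : (H.card : ℝ) ^ 2 * 256 ≤ ε * D := by
      calc (H.card : ℝ) ^ 2 * 256 ≤ (H.card : ℝ) ^ 2 * 256 * (Q * ε) :=
            le_mul_of_one_le_right (by positivity) hQε
        _ = ε * ((H.card : ℝ) ^ 2 * (256 * Q)) := by ring
        _ ≤ ε * D := by gcongr
    have h4 : ε * D ≤ ε * M := by gcongr
    have h5 : 0 ≤ ε * M := by positivity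
    linarith
  have hlight : ∀ i, i ∉ H → ((N i).card : ℝ) / s < 2 * ((64 * Q : ℕ) : ℝ) :=
    fun i hi => card_lt_of_notMem_heavySet hf hi
  have hWle : ∀ i, W i ≤ 256 * Q * s := by
    intro i
    have := rowWeight_le N (H := H) (i := i) (b := 128 * Q * s) (by positivity) fun hi => by
      have := hlight i hi
      rw [div_lt_iff₀ hs] at this
      push_cast at this
      linarith
    linarith
  refine IPAlgorithm.prob_drawFrom_le
    (bad := fun rows => ε / 4 * (T * M / n) < |∑ t, W (rows t) - T * (∑ i, W i) / n|)
    (by positivity) ((uniformProb_sum_sample (b := 256 * Q * s) (by positivity)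
      (rowWeight_nonneg N H) hWle (hW1.trans hDM) (by linarith) (by linarith)).trans ?_)
    fun rows hrows => ?_
  · gcongr
    have : (ε / 4) ^ 2 * (T * M / (256 * Q * s * n)) / 4 =
        ε ^ 2 * (T * M) / (2 ^ 14 * Q * s * n) := by
      field_simp
      norm_num
    rw [this, le_div_iff₀ (by positivity)]
    calc 2 * (Q : ℝ) * (2 ^ 14 * Q * s * n) = 2 ^ 15 * Q ^ 2 * n * s := by ring
      _ ≤ _ := hTM'
  rw [not_lt] at hrows
  have hR : (∑ t, W (rows t)) / (2 * s) ≤ T * M / (n * s) := by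
    have h1 := (abs_le.mp hrows).2
    have h2 : T * (∑ i, W i) / n ≤ T * M / n := by
      gcongr
      exact hW1.trans hDM
    have h3 : ε / 4 * (T * M / n) ≤ T * M / n := by
      exact mul_le_of_le_one_left (by positivity) (by linarith)
    rw [div_le_div_iff₀ (by positivity) (by positivity)]
    have h4 : ∑ t, W (rows t) ≤ 2 * (T * M / n) := by linarith
    calc (∑ t, W (rows t)) * (n * s) ≤ 2 * (T * M / n) * (n * s) := by gcongr
      _ = T * M * (2 * s) := by field_simp
  have hcols : uniformProb (fun g : Fin T × Fin n → Fin s =>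
      2 * (ε / 8) * (T * M / (n * s)) < |(∑ t, if rows t ∈ H then 0 else
        ∑ j ∈ hits (N (rows t)) (fun j => g (t, j)), entryWeight H j) -
          (∑ t, rowWeight N H (rows t)) / s|) ≤ 2 * Real.exp (-(2 * Q)) := by
    refine (uniformProb_sum_hits N H rows hR (by linarith) (by linarith)).trans ?_
    gcongr
    have : (ε / 8) ^ 2 * (T * M / (n * s)) / 4 = ε ^ 2 * (T * M) / (2 ^ 8 * n * s) := by
      field_simp
      norm_num
    rw [this, le_div_iff₀ (by positivity)]
    refine le_trans ?_ hTM'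
    have : (0 : ℝ) ≤ n * s := by positivity
    nlinarith [mul_le_mul_of_nonneg_right hQ2 (by positivity : (0 : ℝ) ≤ Q * (n * s))]
  have hcutoff := uniformProb_exists_not_hitsConcentrated (s := s) (T := T) N (64 * Q)
  rw [hexpK] at hcutoff
  have hbad := (uniformProb_or_le _ _).trans (add_le_add hcols hcutoff)
  refine IPAlgorithm.prob_drawFrom_le (by positivity) hbad fun g hg => ?_
  push Not at hg
  obtain ⟨hg1, hg2⟩ := hg
  have hcut : ∀ t, rows t ∉ heavySet (differSet A B) (64 * Q) f →
      (hits (differSet A B (rows t)) fun j => g (t, j)).card < 4 * (64 * Q) :=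
    fun t ht => card_hits_lt_of_card_lt hQ0 (hg2 t) (hlight _ ht)
  have hacc := abs_scaled_sub_le hT0 hn hs hW1 (by linarith) hrows hg1
  have hfinal := prob_drawFrom_estimate_le (L := 4 * Q) he f rows g hcut (next := next) (E := E) hδ
    fun q hq => hnext _ q hacc hq
  exact hfinal

/-! ### Searching for the right guess -/

/-- The number of rows sampled for the guess `4 ^ l`. -/
def sampleSize (n Q l : ℕ) : ℕ := 2 ^ 19 * Q ^ 4 * n / 2 ^ l + 1

/-- Try the guesses `4 ^ l, 4 ^ (l - 1), …, 1` for the distance in this order, until the estimate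
is at least an eighth of the guess. For the last guess the estimate is accurate up to `1 / 32` if
the distance is `0`, and is then rounded to `0`. -/
noncomputable def guessLoop (n : ℕ) [NeZero n] (Q e : ℕ) : ℕ → IPAlgorithm n
  | 0 => guessAlg (2 ^ 0) (sampleSize n Q 0) (64 * Q) (4 * Q) e fun x =>
      IPAlgorithm.output (if x < 1 / 2 then 0 else x)
  | l + 1 => guessAlg (2 ^ (l + 1)) (sampleSize n Q (l + 1)) (64 * Q) (4 * Q) e fun x =>
      open Classical in
      if ((2 ^ (l + 1) : ℕ) : ℝ) ^ 2 / 8 ≤ x then IPAlgorithm.output x else guessLoop n Q e l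

lemma le_sampleSize_mul (n Q l : ℕ) : 2 ^ 19 * Q ^ 4 * n ≤ sampleSize n Q l * 2 ^ l := by
  have h := Nat.lt_mul_div_succ (2 ^ 19 * Q ^ 4 * n) (Nat.two_pow_pos l)
  rw [sampleSize, mul_comm _ (2 ^ l)]
  exact h.le

/-- The failure probability for a single guess. -/
noncomputable def guessFailure (n Q T : ℕ) : ℝ :=
  n * (2 * Real.exp (-(2 * Q))) + (2 * Real.exp (-(2 * Q)) +
    ((2 * Real.exp (-(2 * Q)) + T * n * (2 * Real.exp (-(2 * Q)))) +
      (T + 1) * n * ((n + 1) ^ 2 * (1 / 2) ^ (4 * Q))))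

/-- The bound on the number of queries for a single guess. -/
def guessCost (Q e T : ℕ) : ℕ := T * (9 * (64 * Q) ^ 2 * ((e + 1) * (2 * (4 * Q))))

/-- As long as the distance is at most the guess `4 ^ l`, the loop either stops with an accurate
estimate or goes on with a guess that is still at least the distance. -/
lemma prob_guessLoop_le {n : ℕ} [NeZero n] {A B : Matrix (Fin n) (Fin n) ℝ} (hA : A.IsSymm)
    (hB : B.IsSymm) {Q e : ℕ} (he : n ≤ 2 ^ e) {ε : ℝ} (hε0 : 0 < ε) (hε1 : ε < 1 / 2)
    (hQ : 1 / ε ≤ Q) {δ q : ℝ} (hδ0 : 0 ≤ δ) (l : ℕ)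
    (hD : (matrixDist A B : ℝ) ≤ ((2 ^ l : ℕ) : ℝ) ^ 2)
    (hδ : ∀ l' ≤ l, guessFailure n Q (sampleSize n Q l') ≤ δ)
    (hq : ∀ l' ≤ l, (matrixDist A B : ℝ) ≤ ((2 ^ l' : ℕ) : ℝ) ^ 2 →
      (guessCost Q e (sampleSize n Q l') : ℝ) ≤ q) :
    (guessLoop n Q e l).prob A B
      (fun d c => ¬ (IsApprox ε d (matrixDist A B : ℝ) ∧ (c : ℝ) ≤ (l + 1) * q)) ≤
      (l + 1) * δ := by
  set D : ℝ := (matrixDist A B : ℝ) with hDdef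
  have hD0 : 0 ≤ D := Nat.cast_nonneg _
  induction l with
  | zero =>
    refine (prob_guessAlg_le (δ := 0) hA hB he hε0 hε1 hQ (le_sampleSize_mul n Q 0) hD le_rfl
      fun x c hx hc => ?_).trans ?_
    · refine (IPAlgorithm.prob_output_eq_zero ?_).le
      rw [not_not]
      have hcost : (c : ℝ) ≤ q := le_trans (by exact_mod_cast hc) (hq 0 le_rfl hD)
      refine ⟨?_, by push_cast; linarith⟩
      simp only [pow_zero, Nat.cast_one, one_pow] at hx
      unfold IsApprox
      rcases Nat.eq_zero_or_pos (matrixDist A B) with h0 | h0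
      · have hD' : D = 0 := by rw [hDdef, h0]; simp
        rw [← hDdef, hD', max_eq_right (by norm_num)] at hx
        have := (abs_le.mp hx).2
        rw [if_pos (by linarith), hD']
        simp
      · have hD' : 1 ≤ D := by
          rw [hDdef]
          exact_mod_cast h0
        rw [← hDdef, max_eq_left (by linarith)] at hx
        have := (abs_le.mp hx).1
        rw [if_neg (by nlinarith)]
        exact hx
    · have := hδ 0 le_rfl
      unfold guessFailure at this
      push_cast
      linarith
  | succ l ih =>
    set s : ℝ := ((2 ^ (l + 1) : ℕ) : ℝ) with hs
    have hs0 : 0 < s := by rw [hs]; positivity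
    have hs2 : s = 2 * ((2 ^ l : ℕ) : ℝ) := by rw [hs]; push_cast; ring
    have hq0 : (guessCost Q e (sampleSize n Q (l + 1)) : ℝ) ≤ q := hq (l + 1) le_rfl hD
    have hq0' : 0 ≤ q := le_trans (Nat.cast_nonneg _) hq0
    refine (prob_guessAlg_le (δ := (l + 1) * δ) hA hB he hε0 hε1 hQ
      (le_sampleSize_mul n Q (l + 1)) hD (by positivity) fun x c hx hc => ?_).trans ?_
    · rw [← hDdef, ← hs] at hx
      have hcost : (c : ℝ) ≤ q := le_trans (by exact_mod_cast hc) hq0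
      split_ifs with hreached
      · rw [IPAlgorithm.prob_output_eq_zero]
        · positivity
        rw [not_not]
        refine ⟨?_, ?_⟩
        · -- stopping is only possible if the distance is at least a sixteenth of the guess
          have hbig : s ^ 2 / 16 ≤ D := by
            by_contra hlt
            push Not at hlt
            rw [max_eq_right hlt.le] at hx
            have := (abs_le.mp hx).2
            have hs3 : 0 < s ^ 2 := by positivity
            nlinarith
          rw [max_eq_left hbig] at hx
          exact hx
        · push_cast
          have : 0 ≤ ((l : ℝ) + 1) * q := by positivity
          linarith
      · -- going on is only possible if the distance is at most a quarter of the guess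
        have hsmall : D ≤ ((2 ^ l : ℕ) : ℝ) ^ 2 := by
          by_contra hlt
          push Not at hlt
          have hquarter : s ^ 2 / 4 ≤ D := by rw [hs2]; linarith
          have hs3 : 0 < s ^ 2 := by positivity
          rw [max_eq_left (by linarith)] at hx
          have := (abs_le.mp hx).1
          refine hreached ?_
          nlinarith
        refine le_trans (IPAlgorithm.prob_mono _ fun d c' hdc => ?_)
          (ih (fun l' hl' => hδ l' (by omega)) hsmall fun l' hl' => hq l' (by omega))
        intro hcon
        refine hdc ⟨hcon.1, ?_⟩
        have := hcon.2
        push_cast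
        linarith
    · have := hδ (l + 1) le_rfl
      unfold guessFailure at this
      push_cast
      linarith

/-! ### Choice of the parameters -/

lemma matrixDist_le_sq {n : ℕ} (A B : Matrix (Fin n) (Fin n) ℝ) : matrixDist A B ≤ n ^ 2 := by
  refine (Finset.card_le_univ _).trans_eq ?_
  simp [pow_two]

/-- The precision parameter of the algorithm: it exceeds `1 / ε` and a large multiple of
`log n`. -/
noncomputable def precision (c n : ℕ) (ε : ℝ) : ℕ := ⌈(c + 50) * ((1 + Real.log n) / ε)⌉₊

section Parameters

variable {c n : ℕ} {ε : ℝ}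

lemma one_le_one_add_log_div (hε0 : 0 < ε) (hε1 : ε < 1 / 2) :
    1 ≤ (1 + Real.log n) / ε := by
  have hlog : 0 ≤ Real.log n := Real.log_natCast_nonneg n
  rw [one_le_div hε0]
  linarith

lemma one_div_le_precision (hε0 : 0 < ε) : 1 / ε ≤ precision c n ε := by
  have hlog : 0 ≤ Real.log n := Real.log_natCast_nonneg n
  refine le_trans ?_ (Nat.le_ceil _)
  have h1 : 1 / ε ≤ (1 + Real.log n) / ε := by gcongr; linarith
  have h2 : (0 : ℝ) ≤ (1 + Real.log n) / ε := by positivity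
  have hc : (0 : ℝ) ≤ c := c.cast_nonneg
  nlinarith

lemma mul_one_add_log_le_precision (hε0 : 0 < ε) (hε1 : ε < 1 / 2) :
    (c + 50) * (1 + Real.log n) ≤ precision c n ε := by
  have hlog : 0 ≤ Real.log n := Real.log_natCast_nonneg n
  refine le_trans ?_ (Nat.le_ceil _)
  gcongr
  exact le_div_self (by linarith) hε0 (by linarith)

lemma precision_le (hε0 : 0 < ε) (hε1 : ε < 1 / 2) :
    (precision c n ε : ℝ) ≤ (c + 51) * ((1 + Real.log n) / ε) := by
  have h := one_le_one_add_log_div (n := n) hε0 hε1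
  have := (Nat.ceil_lt_add_one (a := (c + 50) * ((1 + Real.log n) / ε)) (by positivity)).le
  unfold precision
  linarith

lemma two_pow_clog_le (hn : 1 ≤ n) : 2 ^ Nat.clog 2 n ≤ 2 * n := by
  rcases hn.eq_or_lt with h | h
  · simp [← h]
  · have h1 := Nat.pow_pred_clog_lt_self one_lt_two h
    have h2 : Nat.clog 2 n = (Nat.clog 2 n).pred + 1 :=
      (Nat.succ_pred_eq_of_pos (Nat.clog_pos one_lt_two h)).symm
    rw [h2, pow_succ]
    omega

lemma clog_add_one_le (hn : 1 ≤ n) : ((Nat.clog 2 n : ℕ) : ℝ) + 1 ≤ 2 * (1 + Real.log n) := by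
  have hn' : (0 : ℝ) < n := by exact_mod_cast hn
  have h : Real.log ((2 : ℝ) ^ Nat.clog 2 n) ≤ Real.log (2 * n) :=
    Real.log_le_log (by positivity) (by exact_mod_cast two_pow_clog_le hn)
  rw [Real.log_pow, Real.log_mul two_ne_zero hn'.ne'] at h
  have hlog := Real.log_natCast_nonneg n
  have h2 := Real.log_two_gt_d9
  by_contra hcon
  push Not at hcon
  have h3 : (1 + 2 * Real.log n) * Real.log 2 < (Nat.clog 2 n : ℕ) * Real.log 2 := by
    have : 0 < Real.log 2 := by linarith
    gcongr
    linarith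
  nlinarith

/-- The number of sampled rows is `O(Q ^ 4 n / s)`. -/
lemma sampleSize_le {Q l : ℕ} (hQ : 1 ≤ Q) (hl : 2 ^ l ≤ 2 * n) :
    (sampleSize n Q l : ℝ) ≤ 2 ^ 20 * Q ^ 4 * n / 2 ^ l := by
  have h1 : ((2 ^ 19 * Q ^ 4 * n / 2 ^ l : ℕ) : ℝ) ≤ 2 ^ 19 * Q ^ 4 * n / 2 ^ l := by
    exact Nat.cast_div_le.trans_eq (by push_cast; ring)
  have hl' : (2 : ℝ) ^ l ≤ 2 * n := by exact_mod_cast hl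
  have hQ' : (1 : ℝ) ≤ (Q : ℝ) ^ 4 := one_le_pow₀ (by exact_mod_cast hQ)
  have h2 : (1 : ℝ) ≤ 2 ^ 19 * Q ^ 4 * n / 2 ^ l := by
    rw [one_le_div (by positivity)]
    have : (n : ℝ) ≤ Q ^ 4 * n := le_mul_of_one_le_left n.cast_nonneg hQ'
    have : (0 : ℝ) ≤ Q ^ 4 * n := by positivity
    linarith
  unfold sampleSize
  push_cast at h1 ⊢
  have e : (2 : ℝ) ^ 20 * Q ^ 4 * n / 2 ^ l = 2 * (2 ^ 19 * Q ^ 4 * n / 2 ^ l) := by ring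
  linarith

lemma half_pow_le_exp (Q : ℕ) : ((1 : ℝ) / 2) ^ (4 * Q) ≤ Real.exp (-(2 * Q)) := by
  have h1 : Real.exp 1 ^ 2 ≤ 16 := by
    have := Real.exp_one_lt_d9
    have h0 := Real.exp_pos 1
    nlinarith
  have h2 : Real.exp (-(2 * Q)) = (1 / Real.exp 1 ^ 2) ^ Q := by
    rw [Real.exp_neg, one_div, inv_pow, ← pow_mul, ← Real.exp_nat_mul]
    push_cast
    ring_nf
  rw [h2, pow_mul]
  have h3 : ((1 : ℝ) / 2) ^ 4 = 1 / 16 := by norm_num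
  rw [h3]
  gcongr

lemma guessFailure_le {Q T : ℕ} (hn : 1 ≤ n) (hT : 1 ≤ T) :
    guessFailure n Q T ≤ 16 * T * n ^ 3 * Real.exp (-(2 * Q)) := by
  have hn' : (1 : ℝ) ≤ n := by exact_mod_cast hn
  have hT' : (1 : ℝ) ≤ T := by exact_mod_cast hT
  have hx := Real.exp_pos (-(2 * (Q : ℝ)))
  have hhalf := half_pow_le_exp Q
  set x := Real.exp (-(2 * (Q : ℝ)))
  have h1 : ((T : ℝ) + 1) * n * ((n + 1) ^ 2 * (1 / 2) ^ (4 * Q)) ≤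
      (2 * T) * n * ((2 * n) ^ 2 * x) := by
    gcongr <;> linarith
  have hn3 : (n : ℝ) ≤ n ^ 3 := le_self_pow₀ hn' (by norm_num)
  have h3 : (n : ℝ) ≤ T * n ^ 3 := hn3.trans (le_mul_of_one_le_left (by positivity) hT')
  have h4 : (T : ℝ) * n ≤ T * n ^ 3 := by gcongr
  have h5 : (n : ℝ) * (2 * x) + (2 * x + (2 * x + T * n * (2 * x))) =
      (2 * n + 4 + 2 * (T * n)) * x := by ring
  have h6 : (2 * n + 4 + 2 * ((T : ℝ) * n)) * x ≤ (8 * (T * n ^ 3)) * x := by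
    gcongr
    linarith
  unfold guessFailure
  linarith

/-- The total failure probability over all guesses is at most `1 / n ^ c`. -/
lemma mul_failure_le (hn : 1 ≤ n) (hε0 : 0 < ε) (hε1 : ε < 1 / 2) :
    (2 * n) * (16 * (2 ^ 20 * (precision c n ε : ℝ) ^ 4 * n) * n ^ 3 *
      Real.exp (-(2 * (precision c n ε : ℝ)))) ≤ 1 / (n : ℝ) ^ c := by
  have hlow := mul_one_add_log_le_precision (c := c) (n := n) hε0 hε1
  set Q : ℝ := (precision c n ε : ℝ)
  have hn' : (1 : ℝ) ≤ n := by exact_mod_cast hn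
  have hn0 : (0 : ℝ) < n := by linarith
  have hQ0 : 0 ≤ Q := Nat.cast_nonneg _
  have hpow : Q ^ 4 ≤ 24 * Real.exp Q := by
    have := Real.pow_div_factorial_le_exp Q hQ0 4
    have h24 : ((Nat.factorial 4 : ℕ) : ℝ) = 24 := by norm_num [Nat.factorial]
    rw [h24, div_le_iff₀ (by norm_num)] at this
    linarith
  have hexp : (2 * (n : ℝ)) ^ (c + 50) ≤ Real.exp Q := by
    have h2 : (2 : ℝ) ≤ Real.exp 1 := by linarith [Real.add_one_le_exp (1 : ℝ)]
    calc (2 * (n : ℝ)) ^ (c + 50) ≤ (Real.exp 1 * n) ^ (c + 50) := by gcongr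
      _ = Real.exp ((c + 50) * (1 + Real.log n)) := by
          rw [mul_comm ((c : ℝ) + 50), Real.exp_mul, Real.exp_add, Real.exp_log hn0]
          rw [← Real.rpow_natCast]
          push_cast
          rfl
      _ ≤ Real.exp Q := Real.exp_le_exp.mpr hlow
  have hbig : 2 ^ 30 * (n : ℝ) ^ 5 * n ^ c ≤ Real.exp Q := by
    refine le_trans ?_ hexp
    calc 2 ^ 30 * (n : ℝ) ^ 5 * n ^ c ≤ 2 ^ (c + 50) * (n : ℝ) ^ 50 * n ^ c := by
          gcongr
          · norm_num
          · omega
          · norm_num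
      _ = (2 * (n : ℝ)) ^ (c + 50) := by ring
  have hsplit : Real.exp (-(2 * Q)) = Real.exp (-Q) * Real.exp (-Q) := by
    rw [← Real.exp_add]; ring_nf
  have hinv : Real.exp Q * Real.exp (-Q) = 1 := by rw [← Real.exp_add]; simp
  have hx := Real.exp_pos (-Q)
  rw [le_div_iff₀ (by positivity), hsplit]
  calc (2 * (n : ℝ)) * (16 * (2 ^ 20 * Q ^ 4 * n) * n ^ 3 *
        (Real.exp (-Q) * Real.exp (-Q))) * n ^ c
      ≤ (2 * (n : ℝ)) * (16 * (2 ^ 20 * (24 * Real.exp Q) * n) * n ^ 3 *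
        (Real.exp (-Q) * Real.exp (-Q))) * n ^ c := by gcongr
    _ = 24 * 2 ^ 25 * n ^ 5 * n ^ c * Real.exp (-Q) * (Real.exp Q * Real.exp (-Q)) := by ring
    _ ≤ 2 ^ 30 * (n : ℝ) ^ 5 * n ^ c * Real.exp (-Q) := by
        rw [hinv, mul_one]
        gcongr
        norm_num
    _ ≤ Real.exp Q * Real.exp (-Q) := by gcongr
    _ = 1 := hinv

/-- The cost of a guess `4 ^ l` that is at least the distance `D`. -/
lemma guessCost_le {Q e l : ℕ} (hn : 1 ≤ n) (hQ : 1 ≤ Q) (he : e + 1 ≤ Q)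
    (hl : 2 ^ l ≤ 2 * n) {D : ℝ} (hD : D ≤ ((2 ^ l : ℕ) : ℝ) ^ 2) :
    (guessCost Q e (sampleSize n Q l) : ℝ) ≤
      2 ^ 39 * (Q : ℝ) ^ 8 * (n / Real.sqrt (max D 1)) := by
  have hT := sampleSize_le hQ hl
  have he' : (e : ℝ) + 1 ≤ Q := by exact_mod_cast he
  have hsqrt : Real.sqrt (max D 1) ≤ 2 ^ l := by
    rw [Real.sqrt_le_left (by positivity)]
    refine max_le (by exact_mod_cast hD) ?_
    exact one_le_pow₀ (one_le_pow₀ one_le_two)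
  have hpos : 0 < Real.sqrt (max D 1) :=
    Real.sqrt_pos.mpr (lt_of_lt_of_le one_pos (le_max_right _ _))
  unfold guessCost
  push_cast
  calc (sampleSize n Q l : ℝ) * (9 * (64 * Q) ^ 2 * ((e + 1) * (2 * (4 * Q))))
      ≤ 2 ^ 20 * (Q : ℝ) ^ 4 * n / 2 ^ l * (9 * (64 * Q) ^ 2 * (Q * (2 * (4 * Q)))) := by gcongr
    _ = 2 ^ 20 * 294912 * (Q : ℝ) ^ 8 * (n / 2 ^ l) := by ring
    _ ≤ 2 ^ 39 * (Q : ℝ) ^ 8 * (n / Real.sqrt (max D 1)) := by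
        gcongr
        norm_num

end Parameters

/-- The algorithm starts from a guess of at least `n ^ 2`; the matrix of size `0` is a dummy
case. -/
noncomputable def distSymmAlg (c n : ℕ) (ε : ℝ) : IPAlgorithm n :=
  if h : n = 0 then IPAlgorithm.output 0
  else
    haveI : NeZero n := ⟨h⟩
    guessLoop n (precision c n ε) (Nat.clog 2 n) (Nat.clog 2 n)

theorem mainTheorem1 (c : ℕ) :
    ∃ (distSymmMatrix : (n : ℕ) → ℝ → IPAlgorithm n) (C : ℝ) (k : ℕ),
      ∀ (n : ℕ), 1 ≤ n → ∀ (ε : ℝ), 0 < ε → ε < 1 / 2 →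
        ∀ (A B : Matrix (Fin n) (Fin n) ℝ), A.IsSymm → B.IsSymm →
          1 - 1 / (n : ℝ) ^ c ≤
            (distSymmMatrix n ε).prob A B (fun d q =>
              IsApprox ε d (matrixDist A B : ℝ) ∧
              (q : ℝ) ≤ C * ((1 + Real.log (n : ℝ)) / ε) ^ k *
                ((n : ℝ) / Real.sqrt (max (matrixDist A B : ℝ) 1))) := by
  refine ⟨distSymmAlg c, 2 ^ 39 * (c + 51) ^ 9, 9, fun n hn ε hε0 hε1 A B hA hB => ?_⟩
  have : NeZero n := ⟨by omega⟩
  set Q := precision c n ε with hQdef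
  set e := Nat.clog 2 n with hedef
  set R : ℝ := (n : ℝ) / Real.sqrt (max (matrixDist A B : ℝ) 1) with hR
  have hR0 : 0 ≤ R := by positivity
  have halg : distSymmAlg c n ε = guessLoop n Q e e := dif_neg (NeZero.ne n)
  have hne : n ≤ 2 ^ e := Nat.le_pow_clog one_lt_two n
  have he2 : 2 ^ e ≤ 2 * n := two_pow_clog_le hn
  have hQε : 1 / ε ≤ Q := one_div_le_precision hε0
  have hQup : (Q : ℝ) ≤ (c + 51) * ((1 + Real.log n) / ε) := precision_le hε0 hε1
  have hlog := Real.log_natCast_nonneg n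
  have heQ' : (e : ℝ) + 1 ≤ Q := by
    refine (clog_add_one_le hn).trans (le_trans ?_
      (mul_one_add_log_le_precision (c := c) (n := n) hε0 hε1))
    gcongr
    linarith [(c.cast_nonneg : (0 : ℝ) ≤ c)]
  have heQ : e + 1 ≤ Q := by exact_mod_cast heQ'
  have hQ1 : 1 ≤ Q := by omega
  have hpow : ∀ l ≤ e, 2 ^ l ≤ 2 * n := fun l hl =>
    (Nat.pow_le_pow_right two_pos hl).trans he2
  set δ : ℝ := 16 * (2 ^ 20 * (Q : ℝ) ^ 4 * n) * n ^ 3 * Real.exp (-(2 * Q)) with hδdef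
  have hδ0 : 0 ≤ δ := by positivity
  have hδ : ∀ l ≤ e, guessFailure n Q (sampleSize n Q l) ≤ δ := by
    intro l hl
    refine (guessFailure_le hn (Nat.le_add_left _ _)).trans ?_
    have hT : (sampleSize n Q l : ℝ) ≤ 2 ^ 20 * Q ^ 4 * n :=
      (sampleSize_le hQ1 (hpow l hl)).trans
        (div_le_self (by positivity) (one_le_pow₀ one_le_two))
    have hmul : 16 * (sampleSize n Q l : ℝ) * n ^ 3 ≤
        16 * (2 ^ 20 * (Q : ℝ) ^ 4 * n) * n ^ 3 :=
      mul_le_mul_of_nonneg_right (by linarith) (by positivity)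
    exact mul_le_mul_of_nonneg_right hmul (Real.exp_pos _).le
  have hD : (matrixDist A B : ℝ) ≤ ((2 ^ e : ℕ) : ℝ) ^ 2 := by
    exact_mod_cast (matrixDist_le_sq A B).trans (Nat.pow_le_pow_left hne 2)
  have hfail := prob_guessLoop_le hA hB hne hε0 hε1 hQε hδ0 e hD hδ
    (q := 2 ^ 39 * (Q : ℝ) ^ 8 * R)
    fun l hl hDl => guessCost_le hn hQ1 heQ (hpow l hl) hDl
  have hetwo : (e : ℝ) + 1 ≤ 2 * n := by
    exact_mod_cast (Nat.lt_two_pow_self (n := e)).trans_le he2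
  have hsmall : ((e : ℝ) + 1) * δ ≤ 1 / (n : ℝ) ^ c :=
    (mul_le_mul_of_nonneg_right hetwo hδ0).trans (mul_failure_le hn hε0 hε1)
  have hcost : ((e : ℝ) + 1) * (2 ^ 39 * (Q : ℝ) ^ 8 * R) ≤
      2 ^ 39 * ((c : ℝ) + 51) ^ 9 * ((1 + Real.log n) / ε) ^ 9 * R := by
    calc ((e : ℝ) + 1) * (2 ^ 39 * (Q : ℝ) ^ 8 * R) ≤ Q * (2 ^ 39 * (Q : ℝ) ^ 8 * R) := by
          gcongr
      _ = 2 ^ 39 * (Q : ℝ) ^ 9 * R := by ring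
      _ ≤ 2 ^ 39 * ((c + 51) * ((1 + Real.log n) / ε)) ^ 9 * R := by gcongr
      _ = _ := by ring
  have hone := IPAlgorithm.one_le_prob_add_prob_not (A := A) (B := B) (guessLoop n Q e e)
    fun d q => IsApprox ε d (matrixDist A B : ℝ) ∧
      (q : ℝ) ≤ ((e : ℝ) + 1) * (2 ^ 39 * (Q : ℝ) ^ 8 * R)
  have hmono := IPAlgorithm.prob_mono (A := A) (B := B) (guessLoop n Q e e)
    (E := fun d q => IsApprox ε d (matrixDist A B : ℝ) ∧
      (q : ℝ) ≤ ((e : ℝ) + 1) * (2 ^ 39 * (Q : ℝ) ^ 8 * R))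
    (E' := fun d q => IsApprox ε d (matrixDist A B : ℝ) ∧
      (q : ℝ) ≤ 2 ^ 39 * ((c : ℝ) + 51) ^ 9 * ((1 + Real.log n) / ε) ^ 9 * R)
    fun d q h => ⟨h.1, h.2.trans hcost⟩
  rw [halg, sub_le_iff_le_add]
  exact hone.trans (add_le_add hmono (hfail.trans hsmall))
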